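/- Let $\mathbb F_q$ be a finite field with $q$ elements, let $n\ge 1$ be an integer with $\gcd(n,q)=1$, and let $\mathrm{rad}(k)$ denote the product of the distinct primes dividing $k$. Let $w$ be an odd prime such that the multiplicative order of $q$ modulo $\mathrm{rad}(n)$ is $w^2$, and assume that $q\not\equiv 3\pmod 4$ or $8\nmid n$. Write $n=w^{v_w(n)}n_1n_2n_3$ with $\mathrm{rad}(n_1)\mid q-1$, $\mathrm{rad}(n_2)\mid \frac{q^w-1}{q-1}$ and $\mathrm{rad}(n_3)\mid\frac{q^{w^2}-1}{q^w-1}$, where $v_p$ is the $p$-adic valuation. Put $$m_{w^2}=\frac{n}{\gcd(n,q^{w^2}-1)},\quad m_{w^2,1}=\frac{n_1}{\gcd(n_1,q-1)},\quad m_{w^2,2}=\frac{n_1n_2}{\gcd(n_1n_2,q^w-1)},\quad l_j=\frac{q^j-1}{\gcd(n,q^j-1)}\ \ (j=1,w,w^2).$$ Let $\mathbb F_q\subset\mathbb F_{q^w}\subset\mathbb F_{q^{w^2}}$, let $\delta$ be a generator of $\mathbb F_{q^{w^2}}^*$, and put $\theta=\delta^{(q^{w^2}-1)/(q-1)}\in\mathbb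 F_q$ and $\pi=\delta^{(q^{w^2}-1)/(q^w-1)}\in\mathbb F_{q^w}$. Write $\{a\}_N$ for the remainder of $a$ on division by $N$. For $t\ge 1$ let $\mathcal S^{(1)}_t$ be the set of integers $u$ with $1\le u\le N:=\gcd(n,q^w-1)$, $\gcd(u,t)=1$, $\frac{q^w-1}{q-1}\nmid u\,l_w$ and $u=\min_{0\le k<w}\{q^ku\}_N$; and let $\mathcal S^{(2)}_t$ be the set of integers $u$ with $1\le u\le N':=\gcd(n,q^{w^2}-1)$, $\gcd(u,t)=1$, $\frac{q^{w^2}-1}{q^w-1}\nmid u\,l_{w^2}$ and $u=\min_{0\le k<w^2}\{q^ku\}_{N'}$. Then: (1) The factorization of $x^n-1$ into irreducible factors over $\mathbb F_q$ is $$x^n-1=\prod_{t\mid m_{w^2,1}}\ \prod_{\substack{1\le u\le \gcd(n,q-1)\\ \gcd(u,t)=1}}\bigl(x^t-\theta^{ul_1}\bigr)\cdot\prod_{t\mid m_{w^2,2}}\ \prod_{u\in\mathcal S^{(1)}_t}\Bigl[\prod_{k=0}^{w-1}\bigl(x^t-\pi^{q^kul_w}\bigr)\Bigr]\cdot\prod_{t\mid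 m_{w^2}}\ \prod_{u\in\mathcal S^{(2)}_t}\Bigl[\prod_{k=0}^{w^2-1}\bigl(x^t-\delta^{q^kul_{w^2}}\bigr)\Bigr],$$ where each binomial $x^t-\theta^{ul_1}$ and each product in square brackets has coefficients in $\mathbb F_q$ and is irreducible over $\mathbb F_q$. (2) The number of monic irreducible factors of $x^n-1$ over $\mathbb F_q$ is $$\frac{w-1}{w}\gcd(n,q-1)\prod_{p\mid m_{w^2,1}}\Bigl(1+v_p(m_{w^2,1})\tfrac{p-1}{p}\Bigr)+\frac{w-1}{w^2}\gcd(n,q^w-1)\prod_{p\mid m_{w^2,2}}\Bigl(1+v_p(m_{w^2,2})\tfrac{p-1}{p}\Bigr)+\frac{1}{w^2}\gcd(n,q^{w^2}-1)\prod_{p\mid m_{w^2}}\Bigl(1+v_p(m_{w^2})\tfrac{p-1}{p}\Bigr),$$ the products being over primes $p$. -/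

import Mathlib

open Polynomial

/-- `n / gcd(n, q^j - 1)`. -/
def mIndex (n q j : ℕ) : ℕ := n / Nat.gcd n (q ^ j - 1)

/-- `(q^j - 1) / gcd(n, q^j - 1)`. -/
def lIndex (n q j : ℕ) : ℕ := (q ^ j - 1) / Nat.gcd n (q ^ j - 1)

/-- The integers `1 ≤ u ≤ N := gcd(n, q^b - 1)`, coprime to `t`, for which `(q^b - 1)/(q^a - 1)` does
not divide `u * (q^b - 1)/gcd(n, q^b - 1)`, and such that `u` is the least of the remainders of
`u, q u, ..., q^(b-1) u` modulo `N`. (The condition for `k = 0` gives `u = u % N`, so that `u` is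
itself one of these remainders.) -/
def orbitReps (n q a b t : ℕ) : Finset ℕ :=
  (Finset.Icc 1 (Nat.gcd n (q ^ b - 1))).filter fun u =>
    Nat.gcd u t = 1 ∧
    ¬ ((q ^ b - 1) / (q ^ a - 1) ∣ u * lIndex n q b) ∧
    ∀ k ∈ Finset.range b, u ≤ (q ^ k * u) % Nat.gcd n (q ^ b - 1)

/-- The product of `1 + v_p(m) (p - 1)/p` over the prime divisors `p` of `m`. -/
def primeWeight (m : ℕ) : ℚ :=
  ∏ p ∈ m.primeFactors, (1 + (padicValNat p m : ℚ) * (((p : ℚ) - 1) / (p : ℚ)))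

/-!
The irreducible factors come from one criterion. Let `F` have `q` elements, let `a` be nonzero of
degree `b` over `F`, and put `Q = q ^ b`. If every prime `r ∣ t` divides `Q - 1` while
`a ^ ((Q - 1) / r) ≠ 1`, and `4 ∣ t` implies `4 ∣ Q - 1`, then `expand F t (minpoly F a)` is
irreducible (`irreducible_expand_of_prime_conditions`). Indeed, a root `α` of an irreducible factor
of degree `k` has order divisible by `r ^ (v_r(t) + v_r(Q - 1))` for each such `r`, and this order
divides `q ^ k - 1 = Q ^ j - 1`, where `k = b * j`; lifting the exponent gives `t ∣ j`
(`dvd_exponent_of_dvd_pow_sub_one`). Over a field containing the conjugates of `a`, the polynomial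
`expand F t (minpoly F a)` becomes the product of the conjugate binomials
`X ^ t - C (a ^ (q ^ k))` (`map_expand_minpoly_eq_prod`). The three families of factors are the
cases `b = 1`, `b = w` and `b = w ^ 2`.

Over the top field `K` the criterion with `b = 1` makes all binomials `X ^ t - C (δ ^ (u * l))`
irreducible. They are distinct divisors of `X ^ n - 1`, and their degrees add up to `n`, because
`t * #{u ≤ N | gcd(u, t) = 1} = N * φ(t)` when all primes of `t` divide `N`; so their product is
`X ^ n - 1` (`X_pow_sub_one_eq_prod_binomials`). The pairs `(t, u)` in this product are regrouped by
descending the tower: those for which the power of `δ` lies in the smaller field are exactly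
the pairs of the level below, and the others form full Frobenius orbits, represented by
`orbitReps` (`prod_coprime_eq_prod_mul_prod_orbitReps`). That the divisors `t` match between levels
is a comparison of valuations (`dvd_div_gcd_iff`, `tower_arithmetic`). Doing this from `w ^ 2` to
`w` and from `w` to `1` gives the factorization after an injective map `F[X] → K[X]`.

Since `X ^ n - 1` is squarefree, the number of monic irreducible factors is the number of indices
in the factorization. The same regrouping, in additive form, expresses it through the numbers of
pairs at the three levels, each equal to `N * ∑ t ∣ m, φ(t) / t = N * primeWeight m`
(`sum_card_coprime_Icc`).
-/

/-! ### Lifting the exponent -/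

/-- Lifting the exponent for `Q ^ j - 1`, with the prime `2` included when `4 ∣ Q - 1`. -/
theorem factorization_pow_sub_one {p Q j : ℕ} (hp : p.Prime) (hQ : 2 ≤ Q) (hj : 0 < j)
    (hpQ : p ∣ Q - 1) (h2 : p = 2 → 4 ∣ Q - 1) :
    (Q ^ j - 1).factorization p = (Q - 1).factorization p + j.factorization p := by
  have := Fact.mk hp
  have hpn : ¬ p ∣ Q := fun h => hp.one_lt.ne' <| by
    have := (Nat.dvd_sub_iff_right (by omega : 1 ≤ Q) h).1 hpQ
    simpa using this
  rcases hp.eq_two_or_odd' with rfl | hodd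
  · have h4 := h2 rfl
    have key := Int.two_pow_sub_pow' (x := (Q : ℤ)) (y := 1) j
      (by have := Int.natCast_dvd_natCast.2 h4; push_cast [Nat.cast_sub (by omega : 1 ≤ Q)] at this
          exact this)
      (by exact_mod_cast hpn)
    have e1 : ((Q : ℤ) ^ j - 1 ^ j) = ((Q ^ j - 1 : ℕ) : ℤ) := by
      rw [Nat.cast_sub (Nat.one_le_pow _ _ (by omega))]; simp
    have e2 : ((Q : ℤ) - 1) = ((Q - 1 : ℕ) : ℤ) := by
      rw [Nat.cast_sub (by omega)]; simp
    have e3 : (2 : ℤ) = ((2 : ℕ) : ℤ) := rfl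
    rw [e1, e2, e3, Int.natCast_emultiplicity, Int.natCast_emultiplicity,
      Int.natCast_emultiplicity] at key
    have : 1 < Q ^ j := Nat.one_lt_pow hj.ne' (by omega)
    rw [Nat.factorization_def _ hp, Nat.factorization_def _ hp, Nat.factorization_def _ hp,
      ← Nat.cast_inj (R := ℕ∞), Nat.cast_add, padicValNat_eq_emultiplicity (by omega),
      padicValNat_eq_emultiplicity (by omega), padicValNat_eq_emultiplicity (by omega), key]
  · have := padicValNat.pow_sub_pow (p := p) hodd (x := Q) (y := 1) (by omega) hpQ hpn hj.ne'
    rw [Nat.factorization_def _ hp, Nat.factorization_def _ hp, Nat.factorization_def _ hp]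
    simpa using this

/-- If the order `e` has the full `r`-adic valuation `v_r(t) + v_r(Q - 1)` at each prime `r ∣ t`,
then `e ∣ Q ^ j - 1` forces `t ∣ j`. As `e ∣ t * (Q - 1)`,
that valuation is full exactly when `e` does not divide `t * (Q - 1) / r`. -/
theorem dvd_exponent_of_dvd_pow_sub_one {e t Q j : ℕ} (hQ : 2 ≤ Q) (ht : 0 < t) (hj : 0 < j)
    (h4 : 4 ∣ t → 4 ∣ Q - 1) (he : e ∣ t * (Q - 1)) (hej : e ∣ Q ^ j - 1)
    (hr : ∀ r, r.Prime → r ∣ t → r ∣ Q - 1 ∧ ¬ e ∣ t * ((Q - 1) / r)) : t ∣ j := by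
  rw [← Nat.factorization_prime_le_iff_dvd ht.ne' hj.ne']
  intro r hrp
  by_cases hrt : r ∣ t
  swap
  · simp [Nat.factorization_eq_zero_of_not_dvd hrt]
  obtain ⟨hrQ, hne⟩ := hr r hrp hrt
  have hQ1 : Q - 1 ≠ 0 := by omega
  have hQj : Q ^ j - 1 ≠ 0 := by
    have : 1 < Q ^ j := Nat.one_lt_pow hj.ne' (by omega)
    omega
  have he0 : e ≠ 0 := fun h => by subst h; exact hQj (by simpa using hej)
  obtain ⟨M, hM⟩ := hrQ
  have hM0 : M ≠ 0 := by rintro rfl; simp at hM; omega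
  have hval : t.factorization r + (Q - 1).factorization r ≤ e.factorization r := by
    by_contra hlt
    apply hne
    rw [hM, Nat.mul_div_cancel_left _ hrp.pos,
      ← Nat.factorization_prime_le_iff_dvd he0 (by positivity)]
    intro s hs
    have h1 := (Nat.factorization_prime_le_iff_dvd he0 (by positivity)).2 he s hs
    rw [hM] at hlt h1
    rw [Nat.factorization_mul ht.ne' (mul_ne_zero hrp.ne_zero hM0),
      Nat.factorization_mul hrp.ne_zero hM0] at h1
    rw [Nat.factorization_mul hrp.ne_zero hM0] at hlt
    rw [Nat.factorization_mul ht.ne' hM0]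
    simp only [Finsupp.add_apply] at h1 hlt ⊢
    rw [hrp.factorization_self] at hlt
    rcases eq_or_ne s r with rfl | hsr
    · omega
    · have : r.factorization s = 0 :=
        Nat.factorization_eq_zero_of_not_dvd fun h => hsr ((Nat.prime_dvd_prime_iff_eq hs hrp).1 h)
      omega
  have hle := (Nat.factorization_prime_le_iff_dvd he0 hQj).2 hej r hrp
  -- the exponent lifts except for `r = 2` with `Q ≡ 3` modulo `4`, and then `v_2(t) = 1`
  by_cases hc : r = 2 → 4 ∣ Q - 1
  · rw [factorization_pow_sub_one hrp hQ hj ⟨M, hM⟩ hc] at hle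
    omega
  · push Not at hc
    obtain ⟨rfl, hc⟩ := hc
    have ht4 : ¬ 4 ∣ t := fun h => hc (h4 h)
    have hv2 : t.factorization 2 < 2 := by
      by_contra h
      exact ht4 ((Nat.prime_two.pow_dvd_iff_le_factorization ht.ne').2 (not_lt.1 h) : 2 ^ 2 ∣ t)
    have hv1 : 1 ≤ t.factorization 2 :=
      (Nat.prime_two.dvd_iff_one_le_factorization ht.ne').1 hrt
    have hqv : (Q - 1).factorization 2 = 1 := by
      have a1 : 1 ≤ (Q - 1).factorization 2 :=
        (Nat.prime_two.dvd_iff_one_le_factorization hQ1).1 ⟨M, hM⟩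
      have a2 : ¬ 2 ≤ (Q - 1).factorization 2 := fun h =>
        hc ((Nat.prime_two.pow_dvd_iff_le_factorization hQ1).2 h : 2 ^ 2 ∣ Q - 1)
      omega
    -- if `j` were odd, `Q ^ j - 1` would have the same `2`-adic valuation as `Q - 1`
    have hjeven : 2 ∣ j := by
      by_contra hodd
      have h4j : 2 ^ 2 ∣ Q ^ j - 1 :=
        (Nat.prime_two.pow_dvd_iff_le_factorization hQj).2 (by omega)
      have hQ4 : Q % 4 = 3 := by omega
      obtain ⟨i, rfl⟩ : ∃ i, j = 2 * i + 1 := ⟨j / 2, by omega⟩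
      have : Q ^ (2 * i + 1) % 4 = 3 := by
        rw [pow_succ, pow_mul, Nat.mul_mod, Nat.pow_mod, Nat.pow_mod Q, hQ4]
        simp
      omega
    have := (Nat.prime_two.dvd_iff_one_le_factorization hj.ne').1 hjeven
    omega

/-! ### Counting residues coprime to `t` -/

theorem coprime_of_modEq {N t u v : ℕ} (h : ∀ r, r.Prime → r ∣ t → r ∣ N) (huv : u ≡ v [MOD N])
    (hu : Nat.gcd u t = 1) : Nat.gcd v t = 1 := by
  change Nat.Coprime _ _
  by_contra hc
  obtain ⟨r, hr, hrv, hrt⟩ := Nat.Prime.not_coprime_iff_dvd.1 hc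
  have hru : r ∣ u := ((huv.of_dvd (h r hr hrt)).dvd_iff dvd_rfl).2 hrv
  exact Nat.Prime.not_coprime_iff_dvd.2 ⟨r, hr, hru, hrt⟩ hu

theorem count_mul_of_periodic {p : ℕ → Prop} [DecidablePred p] {c : ℕ}
    (hp : Function.Periodic p c) (k : ℕ) : Nat.count p (c * k) = k * Nat.count p c := by
  induction k with
  | zero => simp
  | succ k ih =>
    rw [Nat.mul_succ, Nat.count_add, ih, Nat.succ_mul]
    congr 2
    ext u
    rw [add_comm, mul_comm, ← smul_eq_mul, hp.nsmul k u]

/-- Coprimality to `t` is periodic with period `t` and, as the primes of `t` divide `N`, also with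
period `N`; both sides count the residues below `N * t`. -/
theorem mul_card_coprime_Icc {N t : ℕ} (h : ∀ r, r.Prime → r ∣ t → r ∣ N) :
    t * ((Finset.Icc 1 N).filter (fun u => Nat.gcd u t = 1)).card = N * t.totient := by
  have pN : Function.Periodic (fun u => Nat.gcd u t = 1) N := fun u =>
    propext ⟨coprime_of_modEq h (by simp [Nat.ModEq]),
      coprime_of_modEq h (by simp [Nat.ModEq])⟩
  have pt : Function.Periodic (fun u => Nat.gcd u t = 1) t := fun u => by simp
  have e1 : Finset.Icc 1 N = Finset.Ico 1 (1 + N) := by ext; simp; omega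
  have e2 : t.totient = Nat.count (fun u => Nat.gcd u t = 1) t := by
    rw [Nat.totient, Nat.count_eq_card_filter_range]
    congr 1
    ext u
    simp [Nat.Coprime, Nat.gcd_comm]
  rw [e1, Nat.filter_Ico_card_eq_of_periodic _ _ _ pN, e2, ← count_mul_of_periodic pN,
    ← count_mul_of_periodic pt, mul_comm]

/-- Both sides are multiplicative in `m`, and they agree on prime powers. -/
theorem sum_totient_div_eq_primeWeight {m : ℕ} (hm : m ≠ 0) :
    ∑ t ∈ m.divisors, (t.totient : ℚ) / t = primeWeight m := by
  let g : ArithmeticFunction ℚ := ⟨fun t => (t.totient : ℚ) / t, by simp⟩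
  have hg : g.IsMultiplicative := by
    rw [ArithmeticFunction.IsMultiplicative.iff_ne_zero]
    refine ⟨by simp [g], fun {a b} _ _ hab => ?_⟩
    simp only [g, ArithmeticFunction.coe_mk, Nat.totient_mul hab]
    push_cast
    rw [mul_div_mul_comm]
  have hsum : ∀ k, ((ArithmeticFunction.zeta : ArithmeticFunction ℚ) * g) k
      = ∑ t ∈ k.divisors, (t.totient : ℚ) / t := fun k => by
    rw [ArithmeticFunction.coe_zeta_mul_apply]; rfl
  rw [← hsum, (ArithmeticFunction.isMultiplicative_zeta.natCast.mul hg).multiplicative_factorization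
    _ hm, primeWeight, Finsupp.prod, Nat.support_factorization]
  refine Finset.prod_congr rfl fun p hp => ?_
  have hp := Nat.prime_of_mem_primeFactors hp
  have hp0 : (p : ℚ) ≠ 0 := by exact_mod_cast hp.ne_zero
  rw [hsum, Nat.sum_divisors_prime_pow hp, Finset.sum_range_succ', ← Nat.factorization_def _ hp]
  have : ∀ k ∈ Finset.range (m.factorization p),
      (((p ^ (k + 1)).totient : ℕ) : ℚ) / ((p ^ (k + 1) : ℕ) : ℚ) = ((p : ℚ) - 1) / p := by
    intro k _
    rw [Nat.totient_prime_pow_succ hp]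
    push_cast [Nat.cast_sub hp.one_le]
    field_simp
    ring
  rw [Finset.sum_congr rfl this]
  simp [add_comm]

theorem sum_mul_card_coprime_Icc {N m : ℕ} (h : ∀ r, r.Prime → r ∣ m → r ∣ N) :
    ∑ t ∈ m.divisors, t * ((Finset.Icc 1 N).filter (fun u => Nat.gcd u t = 1)).card = N * m := by
  rw [Finset.sum_congr rfl fun t ht => mul_card_coprime_Icc fun r hr hrt =>
    h r hr (hrt.trans (Nat.dvd_of_mem_divisors ht)), ← Finset.mul_sum, Nat.sum_totient]

theorem sum_card_coprime_Icc {N m : ℕ} (hm : m ≠ 0) (h : ∀ r, r.Prime → r ∣ m → r ∣ N) :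
    ((∑ t ∈ m.divisors, ((Finset.Icc 1 N).filter (fun u => Nat.gcd u t = 1)).card : ℕ) : ℚ)
      = N * primeWeight m := by
  rw [← sum_totient_div_eq_primeWeight hm, Finset.mul_sum]
  push_cast
  refine Finset.sum_congr rfl fun t ht => ?_
  have ht0 : (t : ℚ) ≠ 0 := by exact_mod_cast (Nat.pos_of_mem_divisors ht).ne'
  have := mul_card_coprime_Icc (N := N) (t := t) fun r hr hrt =>
    h r hr (hrt.trans (Nat.dvd_of_mem_divisors ht))
  rw [← mul_div_assoc, eq_div_iff ht0]
  exact_mod_cast (mul_comm _ _).trans this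

/-! ### Frobenius orbits of exponents and descent in the tower -/

/-- For `A = q ^ a - 1`, `B = q ^ b - 1` and `N = gcd(n, B)`, this rewrites the condition excluding
`u` from `orbitReps`. -/
theorem div_dvd_mul_div_iff {A B N u : ℕ} (hB : 0 < B) (hAB : A ∣ B) (hNB : N ∣ B) :
    B / A ∣ u * (B / N) ↔ N ∣ u * A := by
  obtain ⟨c, hc⟩ := hAB
  obtain ⟨l, hl⟩ := hNB
  have hA : 0 < A := Nat.pos_of_ne_zero fun h => by simp [h] at hc; omega
  have hN : 0 < N := Nat.pos_of_ne_zero fun h => by simp [h] at hl; omega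
  have hl0 : 0 < l := Nat.pos_of_ne_zero fun h => by simp [h] at hl; omega
  have e1 : B / A = c := by rw [hc, Nat.mul_div_cancel_left _ hA]
  have e2 : B / N = l := by rw [hl, Nat.mul_div_cancel_left _ hN]
  rw [e1, e2, ← Nat.mul_dvd_mul_iff_left hA, ← hc, hl,
    show A * (u * l) = u * A * l by ring, Nat.mul_dvd_mul_iff_right hl0]

/-- If `N` divides `q ^ b - 1`, powers of `q` modulo `N` depend only on the exponent modulo `b`. -/
theorem pow_modEq_pow_mod {q N b : ℕ} (hq : 2 ≤ q) (hN : N ∣ q ^ b - 1) (i : ℕ) :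
    q ^ i ≡ q ^ (i % b) [MOD N] := by
  have h1 : q ^ b ≡ 1 [MOD N] :=
    ((Nat.modEq_iff_dvd' (Nat.one_le_pow _ _ (by omega))).2 hN).symm
  conv_lhs => rw [← Nat.mod_add_div i b, pow_add, pow_mul]
  simpa using (Nat.ModEq.refl (q ^ (i % b))).mul (h1.pow (i / b))

/-- The residues `u` modulo `N` satisfying an invariant condition fall into full orbits of length
`b` under multiplication by `q`, each represented by its least element. -/
@[to_additive]
theorem prod_orbit_eq {M : Type*} [CommMonoid M] {q N a b t : ℕ} (hq : 2 ≤ q) (hb : 0 < b)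
    (hN0 : 0 < N) (hN : N ∣ q ^ b - 1) (hab : ∀ j, 0 < j → j < b → Nat.gcd j b ∣ a)
    (ht : ∀ r, r.Prime → r ∣ t → r ∣ N) {Ψ : ℕ → M} (hΨ : Function.Periodic Ψ N) :
    ∏ u ∈ (Finset.Icc 1 N).filter (fun u => Nat.gcd u t = 1 ∧ ¬ N ∣ u * (q ^ a - 1)), Ψ u =
      ∏ u ∈ (Finset.Icc 1 N).filter (fun u => Nat.gcd u t = 1 ∧ ¬ N ∣ u * (q ^ a - 1) ∧
          ∀ k ∈ Finset.range b, u ≤ (q ^ k * u) % N),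
        ∏ k ∈ Finset.range b, Ψ (q ^ k * u) := by
  have hqN : Nat.Coprime N q := by
    have h1 : Nat.Coprime (q ^ b - 1) (q ^ b) := by
      have := (Nat.coprime_self_add_right (m := q ^ b - 1) (n := 1)).2 (by simp)
      rwa [Nat.sub_add_cancel (Nat.one_le_pow _ _ (by omega))] at this
    exact Nat.Coprime.coprime_dvd_right (dvd_pow_self q hb.ne') (h1.coprime_dvd_left hN)
  have hmod : ∀ i, q ^ i ≡ q ^ (i % b) [MOD N] := pow_modEq_pow_mod hq hN
  rw [Finset.prod_sigma']
  symm
  refine Finset.prod_bij (fun x _ => (q ^ x.2 * x.1) % N) ?_ ?_ ?_ ?_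
  · rintro ⟨u, k⟩ hx
    simp only [Finset.mem_sigma, Finset.mem_filter, Finset.mem_Icc, Finset.mem_range] at hx ⊢
    obtain ⟨⟨-, hut, hnd, -⟩, -⟩ := hx
    have hcop : Nat.Coprime N (q ^ k) := hqN.pow_right k
    refine ⟨⟨Nat.pos_of_ne_zero fun h0 => ?_, (Nat.mod_lt _ hN0).le⟩, ?_, fun h => ?_⟩
    · exact hnd ((hcop.dvd_of_dvd_mul_left (Nat.dvd_of_mod_eq_zero h0)).mul_right _)
    · refine coprime_of_modEq ht (Nat.mod_modEq _ _).symm ?_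
      refine Nat.Coprime.mul_left ?_ hut
      by_contra hc
      obtain ⟨r, hr, hrv, hrt⟩ := Nat.Prime.not_coprime_iff_dvd.1 hc
      exact Nat.Prime.not_coprime_iff_dvd.2 ⟨r, hr, ht r hr hrt, hrv⟩ hcop
    · have := (((Nat.mod_modEq (q ^ k * u) N).mul_right (q ^ a - 1)).dvd_iff dvd_rfl).1 h
      rw [mul_assoc] at this
      exact hnd (hcop.dvd_of_dvd_mul_left this)
  -- two least elements `u`, `u'` of one orbit coincide, and `u ≡ q ^ j * u` with `0 < j < b`
  -- would give `N ∣ u * (q ^ gcd(j, b) - 1)`, hence `N ∣ u * (q ^ a - 1)`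
  · have key : ∀ u k u' k', (1 ≤ u ∧ u ≤ N) → ¬ N ∣ u * (q ^ a - 1) →
        (∀ k < b, u ≤ q ^ k * u % N) → (1 ≤ u' ∧ u' ≤ N) → ¬ N ∣ u' * (q ^ a - 1) →
        (∀ k < b, u' ≤ q ^ k * u' % N) → k' < b → k ≤ k' →
        q ^ k * u ≡ q ^ k' * u' [MOD N] → u = u' ∧ k = k' := by
      intro u k u' k' _ hnd hmin _ hnd' hmin' hk' hkk h
      have hlt : u < N := (hmin 0 hb).trans_lt (Nat.mod_lt _ hN0)
      have hlt' : u' < N := (hmin' 0 hb).trans_lt (Nat.mod_lt _ hN0)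
      obtain ⟨j, rfl⟩ := Nat.exists_eq_add_of_le hkk
      have h1 : u ≡ q ^ j * u' [MOD N] := by
        rw [pow_add, mul_assoc] at h
        exact Nat.ModEq.cancel_left_of_coprime (hqN.pow_right k) h
      have e1 : q ^ j * u' % N = u := by rw [← h1, Nat.mod_eq_of_lt hlt]
      rcases Nat.eq_zero_or_pos j with rfl | hj
      · simp [Nat.mod_eq_of_lt hlt'] at e1
        simp [e1]
      exfalso
      have h2 : q ^ (b - j) * u ≡ u' [MOD N] := by
        have := (h1.mul_left (q ^ (b - j)))
        rw [← mul_assoc, ← pow_add, Nat.sub_add_cancel (by omega)] at this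
        refine this.trans ?_
        simpa using (hmod b).mul_right u'
      have e2 : q ^ (b - j) * u % N = u' := by rw [h2, Nat.mod_eq_of_lt hlt']
      have hle := hmin (b - j) (by omega)
      have hle' := hmin' j (by omega)
      rw [e1] at hle'
      rw [e2] at hle
      obtain rfl : u = u' := le_antisymm hle hle'
      have d1 : N ∣ u * (q ^ j - 1) := by
        rw [Nat.mul_sub, mul_one]
        rw [mul_comm] at h1
        exact (Nat.modEq_iff_dvd' (Nat.le_mul_of_pos_right _ (Nat.pow_pos (by omega)))).1 h1
      have d2 : N ∣ u * (q ^ b - 1) := hN.mul_left u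
      have d3 := Nat.dvd_gcd d1 d2
      rw [Nat.gcd_mul_left, Nat.pow_sub_one_gcd_pow_sub_one] at d3
      exact hnd (d3.trans (Nat.mul_dvd_mul_left u
        (Nat.pow_sub_one_dvd_pow_sub_one _ (hab j hj (by omega)))))
    rintro ⟨u, k⟩ hx ⟨u', k'⟩ hx' h
    simp only [Finset.mem_sigma, Finset.mem_filter, Finset.mem_Icc, Finset.mem_range] at hx hx'
    obtain ⟨⟨h1, -, h2, h3⟩, h4⟩ := hx
    obtain ⟨⟨h1', -, h2', h3'⟩, h4'⟩ := hx'
    rcases le_total k k' with hkk | hkk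
    · obtain ⟨rfl, rfl⟩ := key u k u' k' h1 h2 h3 h1' h2' h3' h4' hkk h
      rfl
    · obtain ⟨rfl, rfl⟩ := key u' k' u k h1' h2' h3' h1 h2 h3 h4 hkk (Eq.symm h)
      rfl
  · intro v hv
    simp only [Finset.mem_filter, Finset.mem_Icc] at hv
    obtain ⟨⟨hv1, hvN⟩, hvt, hnd⟩ := hv
    -- the representative of the orbit of `v` is its least element `q ^ k₀ * v % N`
    obtain ⟨k₀, hk₀, hmin⟩ := Finset.exists_min_image (Finset.range b)
      (fun k => (q ^ k * v) % N) ⟨0, Finset.mem_range.2 hb⟩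
    rw [Finset.mem_range] at hk₀
    have hcop : Nat.Coprime N (q ^ k₀) := hqN.pow_right k₀
    have hu : q ^ k₀ * v % N ≡ q ^ k₀ * v [MOD N] := Nat.mod_modEq _ _
    have hvlt : v < N := lt_of_le_of_ne hvN fun h => hnd (by rw [h]; exact dvd_mul_right _ _)
    refine ⟨⟨q ^ k₀ * v % N, (b - k₀) % b⟩, ?_, ?_⟩
    · simp only [Finset.mem_sigma, Finset.mem_filter, Finset.mem_Icc, Finset.mem_range]
      refine ⟨⟨⟨Nat.pos_of_ne_zero fun h0 => ?_, (Nat.mod_lt _ hN0).le⟩, ?_, fun h => ?_, ?_⟩,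
        Nat.mod_lt _ hb⟩
      · exact hnd ((hcop.dvd_of_dvd_mul_left (Nat.dvd_of_mod_eq_zero h0)).mul_right _)
      · refine coprime_of_modEq ht hu.symm ?_
        refine Nat.Coprime.mul_left ?_ hvt
        by_contra hc
        obtain ⟨r, hr, hrv, hrt⟩ := Nat.Prime.not_coprime_iff_dvd.1 hc
        exact Nat.Prime.not_coprime_iff_dvd.2 ⟨r, hr, ht r hr hrt, hrv⟩ hcop
      · have := ((hu.mul_right (q ^ a - 1)).dvd_iff dvd_rfl).1 h
        rw [mul_assoc] at this
        exact hnd (hcop.dvd_of_dvd_mul_left this)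
      · intro k _
        have := hmin ((k + k₀) % b) (Finset.mem_range.2 (Nat.mod_lt _ hb))
        refine this.trans_eq ?_
        refine ((hmod (k + k₀)).symm.mul_right v).trans ?_
        rw [pow_add, mul_assoc]
        exact (hu.mul_left _).symm
    · have : q ^ ((b - k₀) % b) * (q ^ k₀ * v % N) ≡ v [MOD N] := by
        refine (hu.mul_left _).trans ?_
        refine ((hmod (b - k₀)).symm.mul_right _).trans ?_
        rw [← mul_assoc, ← pow_add, Nat.sub_add_cancel hk₀.le]
        simpa using (hmod b).mul_right v
      exact Eq.trans this (Nat.mod_eq_of_lt hvlt)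
  · rintro ⟨u, k⟩ _
    exact (hΨ.map_mod_nat _).symm

/-- The index set at the level of `q ^ b - 1` splits into the part coming from the level of
`q ^ a - 1` (indices divisible by `gcd(n, q ^ b - 1) / gcd(n, q ^ a - 1)`) and full orbits. -/
@[to_additive]
theorem prod_coprime_eq_prod_mul_prod_orbitReps {M : Type*} [CommMonoid M] {n q a b m m' : ℕ}
    (hq : 2 ≤ q) (ha : 0 < a) (hb : 0 < b) (hdvd : a ∣ b) (hn : 0 < n) (hm : m ≠ 0) (hm' : m' ≠ 0)
    (hab : ∀ j, 0 < j → j < b → Nat.gcd j b ∣ a)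
    (hmN : ∀ r, r.Prime → r ∣ m → r ∣ Nat.gcd n (q ^ b - 1))
    (hmm' : ∀ t, t ∣ m' ↔
      t ∣ m ∧ Nat.Coprime t (Nat.gcd n (q ^ b - 1) / Nat.gcd n (q ^ a - 1)))
    {Ψ : ℕ → ℕ → M} (hΨ : ∀ t, Function.Periodic (Ψ t) (Nat.gcd n (q ^ b - 1))) :
    ∏ t ∈ m.divisors, ∏ u ∈ (Finset.Icc 1 (Nat.gcd n (q ^ b - 1))).filter
        (fun u => Nat.gcd u t = 1), Ψ t u =
      (∏ t ∈ m'.divisors, ∏ u ∈ (Finset.Icc 1 (Nat.gcd n (q ^ a - 1))).filter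
        (fun u => Nat.gcd u t = 1),
          Ψ t (u * (Nat.gcd n (q ^ b - 1) / Nat.gcd n (q ^ a - 1)))) *
      ∏ t ∈ m.divisors, ∏ u ∈ orbitReps n q a b t, ∏ k ∈ Finset.range b, Ψ t (q ^ k * u) := by
  have hA0 : 0 < q ^ a - 1 := Nat.sub_pos_of_lt (Nat.one_lt_pow ha.ne' (by omega))
  have hB0 : 0 < q ^ b - 1 := Nat.sub_pos_of_lt (Nat.one_lt_pow hb.ne' (by omega))
  have hAB : q ^ a - 1 ∣ q ^ b - 1 := Nat.pow_sub_one_dvd_pow_sub_one _ hdvd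
  have hreps : ∀ t, orbitReps n q a b t = (Finset.Icc 1 (Nat.gcd n (q ^ b - 1))).filter
      (fun u => Nat.gcd u t = 1 ∧ ¬ Nat.gcd n (q ^ b - 1) ∣ u * (q ^ a - 1) ∧
          ∀ k ∈ Finset.range b, u ≤ (q ^ k * u) % Nat.gcd n (q ^ b - 1)) := by
    intro t
    simp only [orbitReps, lIndex, div_dvd_mul_div_iff hB0 hAB (Nat.gcd_dvd_right n _)]
  have hN' : Nat.gcd (Nat.gcd n (q ^ b - 1)) (q ^ a - 1) = Nat.gcd n (q ^ a - 1) := by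
    rw [Nat.gcd_assoc, Nat.gcd_eq_right hAB]
  have hN0 : 0 < Nat.gcd n (q ^ b - 1) := Nat.gcd_pos_of_pos_left _ hn
  have hN'0 : 0 < Nat.gcd n (q ^ a - 1) := Nat.gcd_pos_of_pos_left _ hn
  simp only [hreps]
  generalize hNdef : Nat.gcd n (q ^ b - 1) = N at *
  generalize Nat.gcd n (q ^ a - 1) = N' at *
  obtain ⟨r, hr⟩ : N' ∣ N := hN' ▸ Nat.gcd_dvd_left _ _
  have hrdiv : N / N' = r := by rw [hr, Nat.mul_div_cancel_left _ hN'0]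
  rw [hrdiv] at hmm' ⊢
  have hr0 : 0 < r := Nat.pos_of_ne_zero fun h => by simp [h] at hr; omega
  -- the excluded indices are the multiples of `r`, since `gcd(N, q ^ a - 1) = N'`
  have hdiv : ∀ u, N ∣ u * (q ^ a - 1) ↔ r ∣ u := by
    intro u
    have hc : Nat.Coprime r ((q ^ a - 1) / N') := by
      have := Nat.coprime_div_gcd_div_gcd (m := N) (n := q ^ a - 1) (by rw [hN']; exact hN'0)
      rwa [hN', hrdiv] at this
    have hA : q ^ a - 1 = (q ^ a - 1) / N' * N' :=
      (Nat.div_mul_cancel (hN' ▸ Nat.gcd_dvd_right _ _)).symm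
    rw [hA, hr, ← mul_assoc, mul_comm _ N', Nat.mul_dvd_mul_iff_left hN'0]
    exact ⟨fun h => hc.dvd_of_dvd_mul_right h, fun h => h.mul_right _⟩
  have hdivs : m'.divisors = m.divisors.filter fun t => Nat.Coprime t r := by
    ext t
    simp [Nat.mem_divisors, hmm', hm, hm']
  rw [hdivs, Finset.prod_filter, ← Finset.prod_mul_distrib]
  refine Finset.prod_congr rfl fun t ht => ?_
  have htN : ∀ s, s.Prime → s ∣ t → s ∣ N := fun s hs hst =>
    hmN s hs (hst.trans (Nat.dvd_of_mem_divisors ht))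
  rw [← prod_orbit_eq hq hb hN0 (hNdef ▸ Nat.gcd_dvd_right _ _) hab htN (hΨ t),
    ← Finset.prod_filter_mul_prod_filter_not _ (fun u => N ∣ u * (q ^ a - 1)),
    Finset.filter_filter, Finset.filter_filter]
  congr 1
  simp only [hdiv]
  split_ifs with hc
  · symm
    refine Finset.prod_bij (fun u _ => u * r) ?_ ?_ ?_ (fun _ _ => rfl)
    · intro u hu
      simp only [Finset.mem_filter, Finset.mem_Icc] at hu ⊢
      refine ⟨⟨Nat.mul_pos hu.1.1 hr0, ?_⟩, Nat.Coprime.mul_left hu.2 hc.symm, dvd_mul_left _ _⟩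
      rw [hr]
      exact Nat.mul_le_mul_right _ hu.1.2
    · intro u _ v _ h
      exact Nat.eq_of_mul_eq_mul_right hr0 h
    · intro v hv
      simp only [Finset.mem_filter, Finset.mem_Icc] at hv
      obtain ⟨⟨h1, h2⟩, h3, u, rfl⟩ := hv
      refine ⟨u, ?_, mul_comm _ _⟩
      simp only [Finset.mem_filter, Finset.mem_Icc]
      refine ⟨⟨Nat.pos_of_mul_pos_left h1, ?_⟩, Nat.Coprime.coprime_mul_left h3⟩
      rw [hr, mul_comm N'] at h2
      exact Nat.le_of_mul_le_mul_left h2 hr0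
  · refine Finset.prod_eq_one fun u hu => ?_
    simp only [Finset.mem_filter] at hu
    obtain ⟨-, h3, h4⟩ := hu
    exact absurd (Nat.Coprime.coprime_dvd_left h4 h3).symm hc

/-- Comparison of the admissible `t` at two consecutive levels: at a prime of `n''` the levels `A`
and `B` have the same valuation, and at a prime of `n'` not dividing `n''` the valuation grows. In
the latter case `p ∤ gcd(n, B) / gcd(n, A)` means that `A` already has the full valuation of `n`,
so that `p` does not divide `n' / gcd(n', B)`. -/
theorem dvd_div_gcd_iff {n n' n'' A B : ℕ} (hn : n ≠ 0) (hn' : n' ∣ n) (hn'' : n'' ∣ n')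
    (hA : A ≠ 0) (hB : B ≠ 0) (hAB : A ∣ B)
    (h1 : ∀ p, p.Prime → p ∣ n' → n'.factorization p = n.factorization p)
    (h2 : ∀ p, p.Prime → p ∣ n'' → n''.factorization p = n.factorization p)
    (h3 : ∀ p, p.Prime → p ∣ n'' → A.factorization p = B.factorization p)
    (h4 : ∀ p, p.Prime → p ∣ n' → ¬ p ∣ n'' → A.factorization p < B.factorization p) (t : ℕ) :
    t ∣ n'' / Nat.gcd n'' A ↔
      t ∣ n' / Nat.gcd n' B ∧ Nat.Coprime t (Nat.gcd n B / Nat.gcd n A) := by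
  have hn'0 : n' ≠ 0 := ne_zero_of_dvd_ne_zero hn hn'
  have hn''0 : n'' ≠ 0 := ne_zero_of_dvd_ne_zero hn'0 hn''
  have pos : ∀ {x y : ℕ}, x ≠ 0 → x / Nat.gcd x y ≠ 0 := fun {x y} hx =>
    (Nat.div_pos (Nat.gcd_le_left _ (Nat.pos_of_ne_zero hx))
      (Nat.gcd_pos_of_pos_left _ (Nat.pos_of_ne_zero hx))).ne'
  have hNN : Nat.gcd n A ∣ Nat.gcd n B := Nat.gcd_dvd_gcd_of_dvd_right _ hAB
  have hr0 : Nat.gcd n B / Nat.gcd n A ≠ 0 := (Nat.div_pos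
    (Nat.le_of_dvd (Nat.gcd_pos_of_pos_left _ (Nat.pos_of_ne_zero hn)) hNN)
      (Nat.gcd_pos_of_pos_left _ (Nat.pos_of_ne_zero hn))).ne'
  have e1 : ∀ {x y : ℕ}, x ≠ 0 → y ≠ 0 → ∀ p, (x / Nat.gcd x y).factorization p =
      x.factorization p - min (x.factorization p) (y.factorization p) := by
    intro x y hx hy p
    rw [Nat.factorization_div (Nat.gcd_dvd_left _ _), Nat.factorization_gcd hx hy]
    rfl
  have e2 : ∀ p, (Nat.gcd n B / Nat.gcd n A).factorization p =
      min (n.factorization p) (B.factorization p) - min (n.factorization p) (A.factorization p) := by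
    intro p
    rw [Nat.factorization_div hNN, Nat.factorization_gcd hn hB, Nat.factorization_gcd hn hA]
    rfl
  by_cases ht : t = 0
  · subst ht
    simp [zero_dvd_iff, pos hn''0, pos hn'0]
  have hcop : Nat.Coprime t (Nat.gcd n B / Nat.gcd n A) ↔ ∀ p, p.Prime →
      t.factorization p = 0 ∨ (Nat.gcd n B / Nat.gcd n A).factorization p = 0 := by
    rw [← not_iff_not, Nat.Prime.not_coprime_iff_dvd]
    push Not
    refine exists_congr fun p => and_congr_right fun hp => ?_
    rw [hp.dvd_iff_one_le_factorization ht, hp.dvd_iff_one_le_factorization hr0]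
    omega
  rw [hcop, ← Nat.factorization_prime_le_iff_dvd ht (pos hn''0),
    ← Nat.factorization_prime_le_iff_dvd ht (pos hn'0), ← forall_and]
  refine forall_congr' fun p => ?_
  rw [← forall_and]
  refine forall_congr' fun hp => ?_
  rw [e1 hn''0 hA, e1 hn'0 hB, e2]
  by_cases c2 : p ∣ n''
  · have := h1 p hp (c2.trans hn'')
    have := h2 p hp c2
    have := h3 p hp c2
    omega
  · have := Nat.factorization_eq_zero_of_not_dvd c2
    by_cases c1 : p ∣ n'
    · have := h1 p hp c1
      have := h4 p hp c1 c2
      omega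
    · have := Nat.factorization_eq_zero_of_not_dvd c1
      omega

/-! ### Irreducibility and conjugates over a finite field -/

/-- Two roots of an irreducible polynomial satisfy the same equations `x ^ s = 1`. -/
theorem pow_eq_one_iff_of_root {F M L : Type*} [Field F] [Field M] [Field L] [Algebra F M]
    [Algebra F L] {p : F[X]} (hp : Irreducible p) {a : M} {b : L} (ha : aeval a p = 0)
    (hb : aeval b p = 0) (s : ℕ) : a ^ s = 1 ↔ b ^ s = 1 := by
  have h1 := hp.dvd_iff_aeval_eq_zero ha (q := X ^ s - 1)
  have h2 := hp.dvd_iff_aeval_eq_zero hb (q := X ^ s - 1)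
  simpa [sub_eq_zero] using h1.trans h2.symm

/-- The irreducibility criterion for `expand F t p`, where `p` has degree `b` and `Q = q ^ b`.
For `p = X - C a` this is the classical criterion for the binomial `X ^ t - C a`. -/
theorem irreducible_expand_of_prime_conditions {F M : Type*} [Field F] [Finite F] [Field M]
    [Algebra F M] {p : F[X]} (hp : Irreducible p) (hpm : p.Monic) {a : M} (ha0 : a ≠ 0)
    (ha : aeval a p = 0) {t Q : ℕ} (hQ : Q = Nat.card F ^ p.natDegree) (ht : 0 < t)
    (hr : ∀ r, r.Prime → r ∣ t → r ∣ Q - 1 ∧ a ^ ((Q - 1) / r) ≠ 1)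
    (h4 : 4 ∣ t → 4 ∣ Q - 1) : Irreducible (expand F t p) := by
  have hb : 0 < p.natDegree := hp.natDegree_pos
  have hQ2 : 2 ≤ Q := hQ ▸ Nat.one_lt_pow hb.ne' Finite.one_lt_card
  have hdeg : (expand F t p).natDegree = p.natDegree * t := natDegree_expand t p
  have hexp0 : expand F t p ≠ 0 := (hpm.expand ht).ne_zero
  obtain ⟨f, hf, hfdvd⟩ := WfDvdMonoid.exists_irreducible_factor
    (not_isUnit_of_natDegree_pos _ (by rw [hdeg]; positivity)) hexp0
  have : Fact (Irreducible f) := ⟨hf⟩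
  set α := AdjoinRoot.root f
  have hαp : aeval (α ^ t) p = 0 := by
    rw [← expand_aeval]
    exact aeval_eq_zero_of_dvd_aeval_eq_zero hfdvd (by simp [α])
  have hfd : FiniteDimensional F (AdjoinRoot f) := (AdjoinRoot.powerBasis hf.ne_zero).finite
  have hfin : Finite (AdjoinRoot f) := Module.finite_of_finite F
  have hrank : Module.finrank F (AdjoinRoot f) = f.natDegree := by
    rw [(AdjoinRoot.powerBasis hf.ne_zero).finrank, AdjoinRoot.powerBasis_dim]
  have hbk : p.natDegree ∣ f.natDegree := by
    rw [← hrank, minpoly.eq_of_irreducible_of_monic hp hαp hpm]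
    exact minpoly.degree_dvd (Algebra.IsIntegral.isIntegral _)
  obtain ⟨j, hj⟩ := hbk
  have hk0 : 0 < f.natDegree := hf.natDegree_pos
  have hj0 : 0 < j := Nat.pos_of_ne_zero fun h => by simp [h] at hj; omega
  have hcard : Nat.card (AdjoinRoot f) = Q ^ j := by
    rw [Module.natCard_eq_pow_finrank (K := F), hrank, hj, pow_mul, hQ]
  have hiff := pow_eq_one_iff_of_root hp ha hαp
  have haQ : a ^ (Q - 1) = 1 := by
    have h1 := (hp.natDegree_dvd_iff_dvd_X_pow_card_pow_sub_X).1 dvd_rfl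
    rw [← hQ, ← hp.dvd_iff_aeval_eq_zero ha] at h1
    simp only [map_sub, map_pow, aeval_X, sub_eq_zero] at h1
    refine mul_right_cancel₀ ha0 ?_
    rw [← pow_succ, Nat.sub_add_cancel (by omega), h1, one_mul]
  have hα0 : α ≠ 0 := by
    intro h
    have := (hiff _).1 haQ
    rw [h, zero_pow ht.ne', zero_pow (by omega)] at this
    exact zero_ne_one this
  have htj : t ∣ j := by
    refine dvd_exponent_of_dvd_pow_sub_one (e := orderOf α) hQ2 ht hj0 h4 ?_ ?_ ?_
    · rw [orderOf_dvd_iff_pow_eq_one, pow_mul]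
      exact (hiff _).1 haQ
    · rw [orderOf_dvd_iff_pow_eq_one, ← hcard]
      have := Fintype.ofFinite (AdjoinRoot f)
      rw [Nat.card_eq_fintype_card]
      exact FiniteField.pow_card_sub_one_eq_one α hα0
    · intro r hrp hrt
      refine ⟨(hr r hrp hrt).1, fun h => (hr r hrp hrt).2 ?_⟩
      rw [orderOf_dvd_iff_pow_eq_one, pow_mul] at h
      exact (hiff _).2 h
  have hle : (expand F t p).natDegree ≤ f.natDegree := by
    rw [hdeg, hj]
    exact Nat.mul_le_mul_left _ (Nat.le_of_dvd hj0 htj)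
  exact (associated_of_dvd_of_natDegree_le hfdvd hexp0 hle).irreducible hf

/-- The conjugates of `a` over a finite field are its iterated Frobenius images. -/
theorem minpoly_map_eq_prod {F M : Type*} [Field F] [Finite F] [Field M] [Finite M] [Algebra F M]
    (a : M) {b : ℕ} (hb : (minpoly F a).natDegree = b) :
    (minpoly F a).map (algebraMap F M) =
      ∏ k ∈ Finset.range b, (X - C (a ^ (Nat.card F ^ k))) := by
  have hint : IsIntegral F a := Algebra.IsIntegral.isIntegral a
  have hirr := minpoly.irreducible hint
  obtain ⟨p, hchar⟩ := CharP.exists F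
  have hp : Fact p.Prime := ⟨CharP.char_is_prime F p⟩
  have hM : CharP M p := charP_of_injective_algebraMap (algebraMap F M).injective p
  obtain ⟨s, -, hs⟩ : ∃ s : ℕ, 0 < s ∧ Nat.card F = p ^ s := by
    have := Fintype.ofFinite F
    obtain ⟨s, h1, h2⟩ := FiniteField.card F p
    exact ⟨s, s.2, by rw [Nat.card_eq_fintype_card, h2]⟩
  have hinj : ∀ k, Function.Injective fun x : M => x ^ (Nat.card F ^ k) := by
    intro k
    rw [hs, ← pow_mul]
    exact iterateFrobenius_inj M p (s * k)
  have hmin : ∀ j, a ^ (Nat.card F ^ j) = a → b ∣ j := by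
    intro j hj
    rw [← hb]
    refine hirr.natDegree_dvd_of_dvd_X_pow_card_pow_sub_X ?_
    rw [minpoly.dvd_iff]
    simp [hj]
  have hroot : ∀ k, aeval (a ^ (Nat.card F ^ k)) (minpoly F a) = 0 := by
    intro k
    have := Fintype.ofFinite F
    induction k with
    | zero => simp
    | succ k ih =>
      rw [pow_succ, pow_mul, Nat.card_eq_fintype_card, ← expand_aeval, FiniteField.expand_card,
        map_pow, ← Nat.card_eq_fintype_card, ih, zero_pow Nat.card_pos.ne']
  have hdist : ∀ i k, i < k → k < b → a ^ (Nat.card F ^ i) ≠ a ^ (Nat.card F ^ k) := by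
    intro i k hik hk h
    obtain ⟨j, rfl⟩ := Nat.exists_eq_add_of_lt hik
    rw [add_assoc, add_comm i, pow_add, pow_mul] at h
    have := Nat.le_of_dvd (by omega) (hmin _ (hinj i h).symm)
    omega
  refine eq_of_monic_of_dvd_of_natDegree_le (monic_prod_of_monic _ _ fun _ _ => monic_X_sub_C _)
    ((minpoly.monic hint).map _) ?_ ?_
  · refine Finset.prod_dvd_of_coprime ?_ ?_
    · intro i hi k hk hik
      refine pairwise_coprime_X_sub_C (s := id) Function.injective_id ?_
      simp at hi hk
      rcases lt_or_gt_of_ne hik with h | h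
      · exact hdist i k h hk
      · exact (hdist k i h hi).symm
    · intro k _
      rw [dvd_iff_isRoot, IsRoot, eval_map_algebraMap]
      exact hroot k
  · rw [natDegree_map, hb, natDegree_prod_of_monic _ _ fun _ _ => monic_X_sub_C _]
    simp only [natDegree_X_sub_C, Finset.sum_const, Finset.card_range, smul_eq_mul, mul_one, le_refl]

/-- Unique factorization counts the monic irreducible divisors of a squarefree polynomial. -/
theorem ncard_monic_irreducible_dvd {F : Type*} [Field F] {P : F[X]} (hP : Squarefree P)
    {S : Multiset F[X]} (hS : ∀ f ∈ S, f.Monic ∧ Irreducible f) (hPS : P = S.prod) :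
    {f : F[X] | f.Monic ∧ Irreducible f ∧ f ∣ P}.ncard = Multiset.card S := by
  classical
  have hnd : S.Nodup := by
    rw [Multiset.nodup_iff_ne_cons_cons]
    rintro f T rfl
    have hf := hS f (by simp)
    refine hf.2.not_isUnit (hP f ?_)
    rw [hPS, Multiset.prod_cons, Multiset.prod_cons, ← mul_assoc]
    exact dvd_mul_right _ _
  have : {f : F[X] | f.Monic ∧ Irreducible f ∧ f ∣ P} = S.toFinset := by
    ext f
    simp only [Set.mem_ofPred_eq, Finset.mem_coe, Multiset.mem_toFinset]
    constructor
    · rintro ⟨hm, hi, hd⟩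
      rw [hPS] at hd
      obtain ⟨g, hg, hfg⟩ := hi.prime.exists_mem_multiset_dvd hd
      have := hS g hg
      rwa [eq_of_monic_of_associated hm this.1 (hi.associated_of_dvd this.2 hfg)]
    · intro hf
      exact ⟨(hS f hf).1, (hS f hf).2, hPS ▸ Multiset.dvd_prod hf⟩
  rw [this, Set.ncard_coe_finset, Multiset.toFinset_card_of_nodup hnd]

/-! ### The binomial factors at one level of the tower -/

/-- A prime `r` dividing `n' / gcd(n', B)` satisfies `v_r(gcd(n, B)) = v_r(B)`, so it does not divide
the cofactor `B / gcd(n, B)`. -/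
theorem prime_dvd_of_dvd_div_gcd {n n' B t u r : ℕ} (hn : n ≠ 0) (hn' : n' ∣ n) (hB : B ≠ 0)
    (hpr : ∀ p, p.Prime → p ∣ n' → p ∣ B) (ht : t ∣ n' / Nat.gcd n' B) (hut : Nat.gcd u t = 1)
    (hr : r.Prime) (hrt : r ∣ t) :
    r ∣ B ∧ ¬ r ∣ u * (B / Nat.gcd n B) := by
  have hn'0 : n' ≠ 0 := ne_zero_of_dvd_ne_zero hn hn'
  have hg : n' / Nat.gcd n' B ≠ 0 := (Nat.div_pos (Nat.gcd_le_left _ (Nat.pos_of_ne_zero hn'0))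
      (Nat.gcd_pos_of_pos_left _ (Nat.pos_of_ne_zero hn'0))).ne'
  have hrn' : r ∣ n' := (hrt.trans ht).trans (Nat.div_dvd_of_dvd (Nat.gcd_dvd_left _ _))
  refine ⟨hpr r hr hrn', fun h => ?_⟩
  rcases hr.dvd_mul.1 h with h | h
  · exact Nat.Prime.not_coprime_iff_dvd.2 ⟨r, hr, h, hrt⟩ hut
  · have h1 := (hr.dvd_iff_one_le_factorization hg).1 (hrt.trans ht)
    have hl : B / Nat.gcd n B ≠ 0 := (Nat.div_pos (Nat.gcd_le_right _ (Nat.pos_of_ne_zero hB))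
      (Nat.gcd_pos_of_pos_left _ (Nat.pos_of_ne_zero hn))).ne'
    have h2 := (hr.dvd_iff_one_le_factorization hl).1 h
    have h3 := (Nat.factorization_prime_le_iff_dvd hn'0 hn).2 hn' r hr
    rw [Nat.factorization_div (Nat.gcd_dvd_left _ _), Nat.factorization_gcd hn'0 hB] at h1
    rw [Nat.factorization_div (Nat.gcd_dvd_right _ _), Nat.factorization_gcd hn hB] at h2
    simp only [Finsupp.coe_tsub, Pi.sub_apply, Finsupp.inf_apply] at h1 h2
    omega

theorem mod_four_eq_three_of_pow {q j : ℕ} (hj : 0 < j) (h : q ^ j % 4 = 3) : q % 4 = 3 := by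
  have hqodd : q % 2 = 1 := by
    rcases Nat.mod_two_eq_zero_or_one q with h' | h'
    · have : 2 ∣ q ^ j := dvd_pow (Nat.dvd_of_mod_eq_zero h') hj.ne'
      omega
    · exact h'
  by_contra hne
  have : q ^ j ≡ 1 ^ j [MOD 4] := Nat.ModEq.pow j (show q % 4 = 1 % 4 by omega)
  rw [one_pow, Nat.ModEq, h] at this
  omega

/-- If `4 ∣ n' / gcd(n', q ^ j - 1)` while `q ^ j - 1` is only divisible by `2`, then `8 ∣ n` and
`q ≡ 3` modulo `4`, the excluded case. -/
theorem four_dvd_of_four_dvd_div_gcd {n n' q j : ℕ} (hq2 : 2 ≤ q) (hn : n ≠ 0) (hn' : n' ∣ n)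
    (hj : Odd j) (hq : ¬ (q ≡ 3 [MOD 4]) ∨ ¬ (8 ∣ n)) (hpr : ∀ p, p.Prime → p ∣ n' → p ∣ q ^ j - 1)
    (h4 : 4 ∣ n' / Nat.gcd n' (q ^ j - 1)) : 4 ∣ q ^ j - 1 := by
  have hn'0 : n' ≠ 0 := ne_zero_of_dvd_ne_zero hn hn'
  have hB : q ^ j - 1 ≠ 0 := by
    have := Nat.one_lt_pow hj.pos.ne' (by omega : 1 < q)
    omega
  have hg : n' / Nat.gcd n' (q ^ j - 1) ≠ 0 :=
    (Nat.div_pos (Nat.gcd_le_left _ (Nat.pos_of_ne_zero hn'0))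
      (Nat.gcd_pos_of_pos_left _ (Nat.pos_of_ne_zero hn'0))).ne'
  have h2n' : 2 ∣ n' :=
    ((by norm_num : 2 ∣ 4).trans h4).trans (Nat.div_dvd_of_dvd (Nat.gcd_dvd_left _ _))
  have h2 : 2 ∣ q ^ j - 1 := hpr 2 Nat.prime_two h2n'
  have hv2 := (Nat.prime_two.dvd_iff_one_le_factorization hB).1 h2
  have hv := (Nat.prime_two.pow_dvd_iff_le_factorization hg (k := 2)).1 h4
  rw [Nat.factorization_div (Nat.gcd_dvd_left _ _), Nat.factorization_gcd hn'0 hB] at hv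
  simp only [Finsupp.coe_tsub, Pi.sub_apply, Finsupp.inf_apply] at hv
  have h8 : 8 ∣ n := ((Nat.prime_two.pow_dvd_iff_le_factorization hn'0 (k := 3)).2
    (by omega)).trans hn'
  have hq3 : ¬ q % 4 = 3 := by
    rcases hq with h | h
    · exact h
    · exact absurd h8 h
  have hpos := Nat.one_le_pow j q (by omega)
  by_contra h4'
  exact hq3 (mod_four_eq_three_of_pow hj.pos (by omega))

/-- Here `γ` generates the units of a field with `q ^ b` elements, which is expressed through its
order; `n'` is a divisor of `n` whose primes all divide `q ^ b - 1`. -/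
theorem irreducible_expand_minpoly {F M : Type*} [Field F] [Finite F] [Field M] [Finite M]
    [Algebra F M] {q b n n' t u : ℕ} (hF : Nat.card F = q) (hn : n ≠ 0) (hn' : n' ∣ n) (hb : Odd b)
    (hq : ¬ (q ≡ 3 [MOD 4]) ∨ ¬ (8 ∣ n)) (hpr : ∀ p, p.Prime → p ∣ n' → p ∣ q ^ b - 1)
    (ht : t ∣ mIndex n' q b) (hut : Nat.gcd u t = 1) {γ : M}
    (hγ : ∀ s, γ ^ s = 1 ↔ q ^ b - 1 ∣ s)
    (hdeg : (minpoly F (γ ^ (u * lIndex n q b))).natDegree = b) :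
    Irreducible (expand F t (minpoly F (γ ^ (u * lIndex n q b)))) := by
  have hq2 : 2 ≤ q := hF ▸ Finite.one_lt_card
  have hB : q ^ b - 1 ≠ 0 := by
    have := Nat.one_lt_pow hb.pos.ne' (by omega : 1 < q)
    omega
  have hn'0 : n' ≠ 0 := ne_zero_of_dvd_ne_zero hn hn'
  have hg : n' / Nat.gcd n' (q ^ b - 1) ≠ 0 :=
    (Nat.div_pos (Nat.gcd_le_left _ (Nat.pos_of_ne_zero hn'0))
      (Nat.gcd_pos_of_pos_left _ (Nat.pos_of_ne_zero hn'0))).ne'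
  have hγ0 : γ ≠ 0 := by
    rintro rfl
    have := (hγ _).2 dvd_rfl
    rw [zero_pow hB] at this
    exact zero_ne_one this
  have hint : IsIntegral F (γ ^ (u * lIndex n q b)) := Algebra.IsIntegral.isIntegral _
  refine irreducible_expand_of_prime_conditions (Q := q ^ b) (minpoly.irreducible hint)
    (minpoly.monic hint) (pow_ne_zero _ hγ0) (minpoly.aeval _ _) (by rw [hF, hdeg])
    (Nat.pos_of_ne_zero (ne_zero_of_dvd_ne_zero hg ht)) ?_ ?_
  · intro r hr hrt
    obtain ⟨h1, h2⟩ := prime_dvd_of_dvd_div_gcd hn hn' hB hpr ht hut hr hrt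
    refine ⟨h1, fun h => h2 ?_⟩
    rw [← pow_mul, hγ] at h
    obtain ⟨c, hc⟩ := h1
    rw [hc, Nat.mul_div_cancel_left _ hr.pos, ← hc] at h
    have hc0 : 0 < c := Nat.pos_of_ne_zero fun h => by simp [h] at hc; omega
    exact (Nat.mul_dvd_mul_iff_right hc0).1 (hc ▸ h)
  · exact fun h => four_dvd_of_four_dvd_div_gcd hq2 hn hn' hb hq hpr (h.trans ht)

/-- The proper divisors of `b` divide `a`, so an element of degree less than `b` satisfies
`x ^ (q ^ a) = x`, which the definition of `orbitReps` excludes. -/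
theorem natDegree_minpoly_of_mem_orbitReps {F M : Type*} [Field F] [Finite F] [Field M] [Finite M]
    [Algebra F M] {q a b n t u : ℕ} (hF : Nat.card F = q) (hM : Nat.card M = q ^ b)
    (hb : 0 < b) (hdvd : a ∣ b) (hab : ∀ j, j ∣ b → j ≠ b → j ∣ a)
    {γ : M} (hγ : ∀ s, γ ^ s = 1 ↔ q ^ b - 1 ∣ s) (hu : u ∈ orbitReps n q a b t) :
    (minpoly F (γ ^ (u * lIndex n q b))).natDegree = b := by
  have hq2 : 2 ≤ q := hF ▸ Finite.one_lt_card
  have hB : 0 < q ^ b - 1 := Nat.sub_pos_of_lt (Nat.one_lt_pow hb.ne' (by omega))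
  have hAB : q ^ a - 1 ∣ q ^ b - 1 := Nat.pow_sub_one_dvd_pow_sub_one _ hdvd
  have hA : 0 < q ^ a - 1 := Nat.pos_of_dvd_of_pos hAB hB
  have hint : IsIntegral F (γ ^ (u * lIndex n q b)) := Algebra.IsIntegral.isIntegral _
  have hrank : Module.finrank F M = b := by
    have := Module.natCard_eq_pow_finrank (K := F) (V := M)
    rw [hM, hF] at this
    exact (Nat.pow_right_injective hq2 this).symm
  have hd := minpoly.degree_dvd hint
  rw [hrank] at hd
  by_contra hne
  have h1 := (minpoly.irreducible hint).natDegree_dvd_iff_dvd_X_pow_card_pow_sub_X.1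
    (hab _ hd hne)
  rw [minpoly.dvd_iff, hF] at h1
  simp only [map_sub, map_pow, aeval_X, sub_eq_zero] at h1
  have hγ0 : γ ≠ 0 := by
    rintro rfl
    have := (hγ _).2 dvd_rfl
    rw [zero_pow hB.ne'] at this
    exact zero_ne_one this
  have h2 : γ ^ (u * lIndex n q b * (q ^ a - 1)) = 1 := by
    rw [pow_mul]
    refine mul_right_cancel₀ (pow_ne_zero (u * lIndex n q b) hγ0) ?_
    rw [← pow_succ, Nat.sub_add_cancel (by omega), h1, one_mul]
  rw [hγ] at h2
  simp only [orbitReps, Finset.mem_filter] at hu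
  refine hu.2.2.1 ?_
  refine (Nat.mul_dvd_mul_iff_right hA).1 ?_
  rwa [Nat.div_mul_cancel hAB]

theorem map_expand_minpoly_eq_prod {F M : Type*} [Field F] [Finite F] [Field M] [Finite M]
    [Algebra F M] {q b t s : ℕ} (hF : Nat.card F = q) {γ : M}
    (hdeg : (minpoly F (γ ^ s)).natDegree = b) :
    (expand F t (minpoly F (γ ^ s))).map (algebraMap F M) =
      ∏ k ∈ Finset.range b, (X ^ t - C (γ ^ (q ^ k * s))) := by
  rw [map_expand, minpoly_map_eq_prod _ hdeg, map_prod]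
  refine Finset.prod_congr rfl fun k _ => ?_
  rw [map_sub, expand_X, expand_C, hF, ← pow_mul, mul_comm s]

/-- Over a field with `q ^ b` elements, where each prime divisor of `n` divides `q ^ b - 1`, the
polynomial `X ^ n - 1` is a product of binomials: these are distinct monic irreducible divisors, and
their degrees add up to `n`. -/
theorem X_pow_sub_one_eq_prod_binomials {K : Type*} [Field K] [Finite K] {q b n : ℕ}
    (hK : Nat.card K = q ^ b) (hq2 : 2 ≤ q) (hn : n ≠ 0) (hb : Odd b)
    (hq : ¬ (q ≡ 3 [MOD 4]) ∨ ¬ (8 ∣ n)) (hpr : ∀ p, p.Prime → p ∣ n → p ∣ q ^ b - 1)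
    {γ : K} (hγ : ∀ s, γ ^ s = 1 ↔ q ^ b - 1 ∣ s) :
    (X ^ n - 1 : K[X]) = ∏ t ∈ (mIndex n q b).divisors,
      ∏ u ∈ (Finset.Icc 1 (Nat.gcd n (q ^ b - 1))).filter (fun u => Nat.gcd u t = 1),
        (X ^ t - C (γ ^ (u * lIndex n q b))) := by
  have hB : q ^ b - 1 ≠ 0 := by
    have := Nat.one_lt_pow hb.pos.ne' (by omega : 1 < q)
    omega
  have hN0 : 0 < Nat.gcd n (q ^ b - 1) := Nat.gcd_pos_of_pos_left _ (Nat.pos_of_ne_zero hn)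
  have hm0 : mIndex n q b ≠ 0 :=
    (Nat.div_pos (Nat.gcd_le_left _ (Nat.pos_of_ne_zero hn)) hN0).ne'
  have hNm : Nat.gcd n (q ^ b - 1) * mIndex n q b = n := Nat.mul_div_cancel' (Nat.gcd_dvd_left _ _)
  have hNl : Nat.gcd n (q ^ b - 1) * lIndex n q b = q ^ b - 1 :=
    Nat.mul_div_cancel' (Nat.gcd_dvd_right _ _)
  have hl0 : 0 < lIndex n q b := Nat.pos_of_ne_zero fun h => by simp [h] at hNl; omega
  have hγ0 : γ ≠ 0 := by
    rintro rfl
    have := (hγ _).2 dvd_rfl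
    rw [zero_pow hB] at this
    exact zero_ne_one this
  have hmono : ∀ t ∈ (mIndex n q b).divisors, ∀ a : K, (X ^ t - C a).Monic := fun t ht a =>
    monic_X_pow_sub_C a (Nat.pos_of_mem_divisors ht).ne'
  have hirr : ∀ t ∈ (mIndex n q b).divisors,
      ∀ u ∈ (Finset.Icc 1 (Nat.gcd n (q ^ b - 1))).filter (fun u => Nat.gcd u t = 1),
        Irreducible (X ^ t - C (γ ^ (u * lIndex n q b))) := by
    intro t ht u hu
    have := irreducible_expand_minpoly (F := K) (q := q ^ b) (b := 1) (n := n) (n' := n) (t := t)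
      (u := u) (γ := γ) hK hn dvd_rfl odd_one ?_ (by simpa using hpr)
      (by simpa [mIndex] using Nat.dvd_of_mem_divisors ht) (Finset.mem_filter.1 hu).2
      (by simpa using hγ) ?_
    · simpa [lIndex, minpoly.eq_X_sub_C'] using this
    -- `q ^ b ≡ 3` modulo `4` would give `q ≡ 3` modulo `4`
    · exact hq.imp_left fun h h' => h (mod_four_eq_three_of_pow hb.pos h')
    · rw [minpoly.eq_X_sub_C', natDegree_X_sub_C]
  rw [Finset.prod_sigma']
  refine eq_of_monic_of_dvd_of_natDegree_le ?_ ?_ ?_ ?_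
  · exact monic_prod_of_monic _ _ fun x hx => hmono _ (Finset.mem_sigma.1 hx).1 _
  · simpa using monic_X_pow_sub_C (1 : K) hn
  · refine Finset.prod_dvd_of_coprime ?_ ?_
    · rintro ⟨t, u⟩ hx ⟨t', u'⟩ hx' hne
      rw [Finset.mem_coe, Finset.mem_sigma] at hx hx'
      have hi := hirr t hx.1 u hx.2
      have hi' := hirr t' hx'.1 u' hx'.2
      refine hi.coprime_iff_not_dvd.2 fun hd => hne ?_
      have heq := eq_of_monic_of_associated (hmono t hx.1 _) (hmono t' hx'.1 _)
        (hi.associated_of_dvd hi' hd)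
      have htt : t = t' := by simpa only [natDegree_X_pow_sub_C] using congrArg natDegree heq
      subst htt
      have hc : γ ^ (u * lIndex n q b) = γ ^ (u' * lIndex n q b) :=
        C_injective (sub_right_injective heq)
      have key : ∀ u v, 1 ≤ u → v ≤ Nat.gcd n (q ^ b - 1) → u ≤ v →
          γ ^ (u * lIndex n q b) = γ ^ (v * lIndex n q b) → u = v := by
        intro u v hu hv huv h
        obtain ⟨j, rfl⟩ := Nat.exists_eq_add_of_le huv
        rw [add_mul, pow_add, eq_comm, mul_eq_left₀ (pow_ne_zero _ hγ0), hγ, ← hNl,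
          Nat.mul_dvd_mul_iff_right hl0] at h
        have := Nat.eq_zero_of_dvd_of_lt h (by omega)
        omega
      simp only [Finset.mem_filter, Finset.mem_Icc] at hx hx'
      rcases le_total u u' with h | h
      · rw [key u u' hx.2.1.1 hx'.2.1.2 h hc]
      · rw [key u' u hx'.2.1.1 hx.2.1.2 h hc.symm]
    · rintro ⟨t, u⟩ hx
      rw [Finset.mem_sigma] at hx
      obtain ⟨s, hs⟩ := Nat.dvd_of_mem_divisors hx.1
      have e : (γ ^ (u * lIndex n q b)) ^ (Nat.gcd n (q ^ b - 1) * s) = 1 := by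
        rw [← pow_mul, hγ, show u * lIndex n q b * (Nat.gcd n (q ^ b - 1) * s) =
          Nat.gcd n (q ^ b - 1) * lIndex n q b * (u * s) by ring, hNl]
        exact dvd_mul_right _ _
      have h1 := sub_dvd_pow_sub_pow ((X : K[X]) ^ t) (C (γ ^ (u * lIndex n q b)))
        (Nat.gcd n (q ^ b - 1) * s)
      rwa [← C_pow, e, C_1, ← pow_mul, mul_left_comm, ← hs, hNm] at h1
  · have : (X ^ n - 1 : K[X]).natDegree = n := by
      simpa using natDegree_X_pow_sub_C (n := n) (r := (1 : K))
    rw [this, natDegree_prod_of_monic _ _ fun x hx => hmono _ (Finset.mem_sigma.1 hx).1 _,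
      Finset.sum_sigma]
    simp only [natDegree_X_pow_sub_C, Finset.sum_const, smul_eq_mul]
    have hs := sum_mul_card_coprime_Icc (N := Nat.gcd n (q ^ b - 1)) (m := mIndex n q b)
      fun r hr hrm => Nat.dvd_gcd (hrm.trans (Dvd.intro_left _ hNm))
        (hpr r hr (hrm.trans (Dvd.intro_left _ hNm)))
    rw [hNm] at hs
    exact (hs.symm.trans (Finset.sum_congr rfl fun _ _ => mul_comm _ _)).le

/-! ### Arithmetic of the tower of degrees `1`, `w`, `w ^ 2` -/

theorem prime_dvd_geom_quotient_iff {p Q j : ℕ} (hQ : 2 ≤ Q) (hp : p ∣ Q - 1) :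
    p ∣ (Q ^ j - 1) / (Q - 1) ↔ p ∣ j := by
  rw [← Nat.geomSum_eq hQ]
  have h1 : Q ≡ 1 [MOD p] := ((Nat.modEq_iff_dvd' (by omega)).2 hp).symm
  have h2 : ∑ k ∈ Finset.range j, Q ^ k ≡ j [MOD p] := by
    simpa using Nat.ModEq.sum (s := Finset.range j) (f := fun k => Q ^ k) (g := fun _ => 1)
      fun k _ => by simpa using h1.pow k
  exact h2.dvd_iff dvd_rfl

theorem factorization_eq_of_not_dvd_quotient {p A B : ℕ} (hB : B ≠ 0) (hAB : A ∣ B)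
    (h : ¬ p ∣ B / A) : A.factorization p = B.factorization p := by
  have h1 := congrArg (fun f => f p) (Nat.factorization_div hAB)
  have h2 := (Nat.factorization_le_iff_dvd (ne_zero_of_dvd_ne_zero hB hAB) hB).2 hAB p
  simp only [Nat.factorization_eq_zero_of_not_dvd h, Finsupp.coe_tsub, Pi.sub_apply] at h1
  omega

theorem factorization_lt_of_dvd_quotient {p A B : ℕ} (hB : B ≠ 0) (hp : p.Prime) (hAB : A ∣ B)
    (h : p ∣ B / A) : A.factorization p < B.factorization p := by
  have h0 : B / A ≠ 0 := (Nat.div_ne_zero_iff_of_dvd hAB).2 ⟨hB, ne_zero_of_dvd_ne_zero hB hAB⟩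
  have h1 := (hp.dvd_iff_one_le_factorization h0).1 h
  rw [Nat.factorization_div hAB] at h1
  simp only [Finsupp.coe_tsub, Pi.sub_apply] at h1
  omega

theorem prime_dvd_of_radical_dvd {m k p : ℕ} (hm : m ≠ 0)
    (h : UniqueFactorizationMonoid.radical m ∣ k) (hp : p.Prime) (hpm : p ∣ m) : p ∣ k :=
  ((UniqueFactorizationMonoid.dvd_radical_iff_of_irreducible hp hm).2 hpm).trans h

/-- Both sides multiplied by `gcd(n, q ^ a - 1)` give `q ^ b - 1`. It identifies the power of a
generator of the large field at index `v * r` with that of the small field at index `v`, where `r` is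
the quotient of the two greatest common divisors. -/
theorem lIndex_mul_quotient {n q a b : ℕ} (hn : 0 < n) (hdvd : a ∣ b) :
    Nat.gcd n (q ^ b - 1) / Nat.gcd n (q ^ a - 1) * lIndex n q b =
      (q ^ b - 1) / (q ^ a - 1) * lIndex n q a := by
  have hAB : q ^ a - 1 ∣ q ^ b - 1 := Nat.pow_sub_one_dvd_pow_sub_one _ hdvd
  have hN0 : 0 < Nat.gcd n (q ^ a - 1) := Nat.gcd_pos_of_pos_left _ hn
  refine Nat.eq_of_mul_eq_mul_left hN0 ?_
  rw [← mul_assoc, Nat.mul_div_cancel' (Nat.gcd_dvd_gcd_of_dvd_right _ hAB), mul_left_comm, lIndex,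
    lIndex, Nat.mul_div_cancel' (Nat.gcd_dvd_right _ _), Nat.mul_div_cancel' (Nat.gcd_dvd_right _ _),
    Nat.div_mul_cancel hAB]

theorem pow_eq_one_iff_of_algebraMap_eq_pow {M K : Type*} [Field M] [Field K] [Algebra M K]
    {A B : ℕ} (hB : 0 < B) (hAB : A ∣ B) {γ : K} (hγ : ∀ s, γ ^ s = 1 ↔ B ∣ s) {η : M}
    (hη : algebraMap M K η = γ ^ (B / A)) (s : ℕ) : η ^ s = 1 ↔ A ∣ s := by
  rw [← (algebraMap M K).injective.eq_iff, map_pow, hη, map_one, ← pow_mul, hγ]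
  obtain ⟨c, rfl⟩ := hAB
  have hA : 0 < A := Nat.pos_of_mul_pos_right hB
  rw [Nat.mul_div_cancel_left _ hA, mul_comm c,
    Nat.mul_dvd_mul_iff_right (Nat.pos_of_mul_pos_left hB)]

/-- The divisibility relations between the levels. The primes of `n₁`, of `n₂` and of `n₃` are
distinct from `w`, and first divide `q ^ j - 1` at `j = 1`, `j = w` and `j = w ^ 2` respectively,
with no further growth of the valuation; if `w ∣ n`, then `w ∣ q - 1` and the valuation at `w` grows
at each level. -/
theorem tower_arithmetic {q w n n₁ n₂ n₃ : ℕ} (hq2 : 2 ≤ q) (hw : w.Prime) (hn : 0 < n)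
    (hrad : ∀ p, p.Prime → p ∣ n → p ∣ q ^ w ^ 2 - 1)
    (hdecomp : n = w ^ padicValNat w n * n₁ * n₂ * n₃)
    (hn₁ : ∀ p, p.Prime → p ∣ n₁ → p ∣ q - 1)
    (hn₂ : ∀ p, p.Prime → p ∣ n₂ → p ∣ (q ^ w - 1) / (q - 1))
    (hn₃ : ∀ p, p.Prime → p ∣ n₃ → p ∣ (q ^ w ^ 2 - 1) / (q ^ w - 1)) :
    (∀ p, p.Prime → p ∣ n₁ * n₂ → p ∣ q ^ w - 1) ∧
    (∀ t, t ∣ mIndex n₁ q 1 ↔ t ∣ mIndex (n₁ * n₂) q w ∧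
      Nat.Coprime t (Nat.gcd n (q ^ w - 1) / Nat.gcd n (q ^ 1 - 1))) ∧
    (∀ t, t ∣ mIndex (n₁ * n₂) q w ↔ t ∣ mIndex n q (w ^ 2) ∧
      Nat.Coprime t (Nat.gcd n (q ^ w ^ 2 - 1) / Nat.gcd n (q ^ w - 1))) := by
  have hA₁ : q - 1 ≠ 0 := by omega
  have hA₁₂ : q - 1 ∣ q ^ w - 1 := by simpa using Nat.pow_sub_one_dvd_pow_sub_one q (one_dvd w)
  have hA₂₃ : q ^ w - 1 ∣ q ^ w ^ 2 - 1 :=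
    Nat.pow_sub_one_dvd_pow_sub_one q (dvd_pow_self w two_ne_zero)
  have hqw : 2 ≤ q ^ w := Nat.one_lt_pow hw.ne_zero (by omega)
  have hA₂ : q ^ w - 1 ≠ 0 := by omega
  have hA₃ : q ^ w ^ 2 - 1 ≠ 0 := by
    have : 1 < q ^ w ^ 2 := Nat.one_lt_pow (pow_ne_zero 2 hw.ne_zero) (by omega)
    omega
  -- a prime dividing `q - 1` (resp. `q ^ w - 1`) divides the next quotient only if it is `w`
  have hc₂ : ∀ p, p.Prime → p ∣ q - 1 → (p ∣ (q ^ w - 1) / (q - 1) ↔ p = w) := fun p hp h =>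
    (prime_dvd_geom_quotient_iff hq2 h).trans (Nat.prime_dvd_prime_iff_eq hp hw)
  have hc₃ : ∀ p, p.Prime → p ∣ q ^ w - 1 →
      (p ∣ (q ^ w ^ 2 - 1) / (q ^ w - 1) ↔ p = w) := fun p hp h => by
    rw [sq, pow_mul]
    exact (prime_dvd_geom_quotient_iff hqw h).trans (Nat.prime_dvd_prime_iff_eq hp hw)
  have h0 : n₁ ≠ 0 ∧ n₂ ≠ 0 ∧ n₃ ≠ 0 := by
    refine ⟨?_, ?_, ?_⟩ <;> rintro rfl <;> simp at hdecomp <;> omega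
  obtain ⟨h₁0, h₂0, h₃0⟩ := h0
  have hfac : ∀ p, n.factorization p = (w ^ padicValNat w n).factorization p +
      n₁.factorization p + n₂.factorization p + n₃.factorization p := by
    intro p
    have hw0 : w ^ padicValNat w n ≠ 0 := pow_ne_zero _ hw.ne_zero
    conv_lhs => rw [hdecomp]
    rw [Nat.factorization_mul (mul_ne_zero (mul_ne_zero hw0 h₁0) h₂0) h₃0,
      Nat.factorization_mul (mul_ne_zero hw0 h₁0) h₂0, Nat.factorization_mul hw0 h₁0]
    rfl
  have hww : ∀ {k}, k ≠ 0 → k.factorization w = 0 → ¬ w ∣ k := fun {k} hk h h' => by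
    have := (hw.dvd_iff_one_le_factorization hk).1 h'
    omega
  have hvw := hfac w
  rw [hw.factorization_pow, Finsupp.single_eq_same, Nat.factorization_def n hw] at hvw
  have hw₁ : ¬ w ∣ n₁ := hww h₁0 (by omega)
  have hw₂ : ¬ w ∣ n₂ := hww h₂0 (by omega)
  have hw₃ : ¬ w ∣ n₃ := hww h₃0 (by omega)
  have hwpow : ∀ p, p.Prime → p ≠ w → (w ^ padicValNat w n).factorization p = 0 := by
    intro p hp hpw
    exact Nat.factorization_eq_zero_of_not_dvd fun h =>
      hpw ((Nat.prime_dvd_prime_iff_eq hp hw).1 (hp.dvd_of_dvd_pow h))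
  -- the valuations at a prime divisor of each factor
  have p₁ : ∀ p, p.Prime → p ∣ n₁ → p ≠ w ∧ p ∣ q - 1 ∧ ¬ p ∣ n₂ ∧ ¬ p ∣ n₃ := by
    intro p hp h
    have hne : p ≠ w := fun e => hw₁ (e ▸ h)
    have hd := hn₁ p hp h
    exact ⟨hne, hd, fun h' => hne ((hc₂ p hp hd).1 (hn₂ p hp h')),
      fun h' => hne ((hc₃ p hp (hd.trans hA₁₂)).1 (hn₃ p hp h'))⟩
  have p₂ : ∀ p, p.Prime → p ∣ n₂ → p ≠ w ∧ ¬ p ∣ q - 1 ∧ p ∣ q ^ w - 1 ∧ ¬ p ∣ n₃ := by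
    intro p hp h
    have hne : p ≠ w := fun e => hw₂ (e ▸ h)
    have hd := (hn₂ p hp h).trans (Nat.div_dvd_of_dvd hA₁₂)
    exact ⟨hne, fun h' => hne ((hc₂ p hp h').1 (hn₂ p hp h)), hd,
      fun h' => hne ((hc₃ p hp hd).1 (hn₃ p hp h'))⟩
  have p₁₂ : ∀ p, p.Prime → p ∣ n₁ * n₂ → p ≠ w ∧ p ∣ q ^ w - 1 ∧ ¬ p ∣ n₃ := by
    intro p hp h
    rcases hp.dvd_mul.1 h with h | h
    · exact ⟨(p₁ p hp h).1, (p₁ p hp h).2.1.trans hA₁₂, (p₁ p hp h).2.2.2⟩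
    · exact ⟨(p₂ p hp h).1, (p₂ p hp h).2.2⟩
  have f₁ : ∀ p, p.Prime → p ∣ n₁ → n₁.factorization p = n.factorization p := by
    intro p hp h
    obtain ⟨hne, -, h2, h3⟩ := p₁ p hp h
    rw [hfac, hwpow p hp hne, Nat.factorization_eq_zero_of_not_dvd h2,
      Nat.factorization_eq_zero_of_not_dvd h3]
    omega
  have f₁₂ : ∀ p, p.Prime → p ∣ n₁ * n₂ → (n₁ * n₂).factorization p = n.factorization p := by
    intro p hp h
    obtain ⟨hne, -, h3⟩ := p₁₂ p hp h
    rw [hfac, hwpow p hp hne, Nat.factorization_eq_zero_of_not_dvd h3,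
      Nat.factorization_mul h₁0 h₂0, Finsupp.add_apply]
    omega
  have d₁₂ : n₁ * n₂ ∣ n := ⟨w ^ padicValNat w n * n₃, by
    conv_lhs => rw [hdecomp]
    ring⟩
  refine ⟨fun p hp h => (p₁₂ p hp h).2.1, fun t => ?_, fun t => ?_⟩
  · simp only [mIndex, pow_one]
    refine dvd_div_gcd_iff hn.ne' d₁₂ (dvd_mul_right _ _) hA₁ hA₂ hA₁₂ f₁₂ f₁ ?_ ?_ t
    · intro p hp h
      obtain ⟨hne, hd, -⟩ := p₁ p hp h
      exact factorization_eq_of_not_dvd_quotient hA₂ hA₁₂ fun h' => hne ((hc₂ p hp hd).1 h')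
    · intro p hp h h'
      have h2 := (hp.dvd_mul.1 h).resolve_left h'
      exact factorization_lt_of_dvd_quotient hA₂ hp hA₁₂ (hn₂ p hp h2)
  · refine dvd_div_gcd_iff hn.ne' dvd_rfl d₁₂ hA₂ hA₃ hA₂₃ (fun _ _ _ => rfl) f₁₂ ?_ ?_ t
    · intro p hp h
      obtain ⟨hne, hd, -⟩ := p₁₂ p hp h
      exact factorization_eq_of_not_dvd_quotient hA₃ hA₂₃ fun h' => hne ((hc₃ p hp hd).1 h')
    · intro p hp h h'
      refine factorization_lt_of_dvd_quotient hA₃ hp hA₂₃ ?_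
      have h3 : p ∣ w ^ padicValNat w n ∨ p ∣ n₃ := by
        rw [hdecomp, mul_assoc (w ^ _) n₁] at h
        rcases hp.dvd_mul.1 h with h | h
        · exact Or.inl ((hp.dvd_mul.1 h).resolve_right h')
        · exact Or.inr h
      rcases h3 with h3 | h3
      · obtain rfl := (Nat.prime_dvd_prime_iff_eq hp hw).1 (hp.dvd_of_dvd_pow h3)
        -- `q ^ (w ^ 2) ≡ q` modulo `w` by Fermat, so `w ∣ q ^ (w ^ 2) - 1` forces `w ∣ q - 1`
        have hfact : Fact p.Prime := ⟨hp⟩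
        have h1 : ((q ^ p ^ 2 : ℕ) : ZMod p) = ((1 : ℕ) : ZMod p) := by
          rw [ZMod.natCast_eq_natCast_iff]
          exact ((Nat.modEq_iff_dvd' (Nat.one_le_pow _ _ (by omega))).2 (hrad p hp
            (hdecomp ▸ (((h3.mul_right _).mul_right _).mul_right _)))).symm
        rw [sq, pow_mul, Nat.cast_pow, Nat.cast_pow, ZMod.pow_card, ZMod.pow_card,
          ZMod.natCast_eq_natCast_iff] at h1
        have h2 : p ∣ q - 1 := (Nat.modEq_iff_dvd' (by omega)).1 h1.symm
        exact (hc₃ p hp (h2.trans hA₁₂)).2 rfl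
      · exact hn₃ p hp h3

/-! ### The factorization and the number of factors -/

theorem periodic_pow_mul_lIndex {L : Type*} [Field L] {γ : L} {n q b : ℕ}
    (hγ : ∀ s, γ ^ s = 1 ↔ q ^ b - 1 ∣ s) :
    Function.Periodic (fun u => γ ^ (u * lIndex n q b)) (Nat.gcd n (q ^ b - 1)) := by
  intro u
  have : γ ^ (Nat.gcd n (q ^ b - 1) * lIndex n q b) = 1 :=
    (hγ _).2 (by rw [lIndex, Nat.mul_div_cancel' (Nat.gcd_dvd_right _ _)])
  simp only [add_mul, pow_add, this, mul_one]

theorem theorem3p3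
    {F E K : Type*} [Field F] [Finite F] [Field E] [Field K]
    [Algebra F E] [Algebra E K] [Algebra F K] [IsScalarTower F E K]
    (q w n n₁ n₂ n₃ : ℕ)
    (hF : Nat.card F = q) (hE : Nat.card E = q ^ w) (hK : Nat.card K = q ^ (w ^ 2))
    (hw : w.Prime) (hw_odd : Odd w) (hn : 0 < n) (hnq : Nat.Coprime n q)
    (hord : orderOf (q : ZMod (UniqueFactorizationMonoid.radical n)) = w ^ 2)
    (hq : ¬ (q ≡ 3 [MOD 4]) ∨ ¬ (8 ∣ n))
    (hdecomp : n = w ^ padicValNat w n * n₁ * n₂ * n₃)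
    (hn₁ : UniqueFactorizationMonoid.radical n₁ ∣ q - 1)
    (hn₂ : UniqueFactorizationMonoid.radical n₂ ∣ (q ^ w - 1) / (q - 1))
    (hn₃ : UniqueFactorizationMonoid.radical n₃ ∣ (q ^ (w ^ 2) - 1) / (q ^ w - 1))
    (δ : Kˣ) (hδ : ∀ x : Kˣ, x ∈ Subgroup.zpowers δ)
    (θ : F) (hθ : algebraMap F K θ = (δ : K) ^ ((q ^ (w ^ 2) - 1) / (q - 1)))
    (π : E) (hπ : algebraMap E K π = (δ : K) ^ ((q ^ (w ^ 2) - 1) / (q ^ w - 1))) :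
    -- the explicit factorization; `g t u` and `h t u` are the products of conjugate binomials,
    -- as polynomials over `F`
    (∃ g h : ℕ → ℕ → F[X],
      (∀ t ∈ (mIndex n₁ q 1).divisors,
        ∀ u ∈ (Finset.Icc 1 (Nat.gcd n (q - 1))).filter (fun u => Nat.gcd u t = 1),
          Irreducible (X ^ t - C (θ ^ (u * lIndex n q 1)) : F[X])) ∧
      (∀ t ∈ (mIndex (n₁ * n₂) q w).divisors, ∀ u ∈ orbitReps n q 1 w t,
          Irreducible (g t u) ∧
          (g t u).map (algebraMap F E) =
            ∏ k ∈ Finset.range w, (X ^ t - C (π ^ (q ^ k * u * lIndex n q w)))) ∧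
      (∀ t ∈ (mIndex n q (w ^ 2)).divisors, ∀ u ∈ orbitReps n q w (w ^ 2) t,
          Irreducible (h t u) ∧
          (h t u).map (algebraMap F K) =
            ∏ k ∈ Finset.range (w ^ 2),
              (X ^ t - C ((δ : K) ^ (q ^ k * u * lIndex n q (w ^ 2))))) ∧
      (X ^ n - 1 : F[X]) =
        (∏ t ∈ (mIndex n₁ q 1).divisors,
          ∏ u ∈ (Finset.Icc 1 (Nat.gcd n (q - 1))).filter (fun u => Nat.gcd u t = 1),
            (X ^ t - C (θ ^ (u * lIndex n q 1)))) *
        (∏ t ∈ (mIndex (n₁ * n₂) q w).divisors, ∏ u ∈ orbitReps n q 1 w t, g t u) *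
        (∏ t ∈ (mIndex n q (w ^ 2)).divisors, ∏ u ∈ orbitReps n q w (w ^ 2) t, h t u)) ∧
    -- the number of monic irreducible factors
    (({f : F[X] | f.Monic ∧ Irreducible f ∧ f ∣ X ^ n - 1}.ncard : ℚ) =
      primeWeight (mIndex n₁ q 1) * (((w : ℚ) - 1) / (w : ℚ)) * (Nat.gcd n (q - 1) : ℚ) +
      primeWeight (mIndex (n₁ * n₂) q w) * (((w : ℚ) - 1) / (w : ℚ) ^ 2) *
        (Nat.gcd n (q ^ w - 1) : ℚ) +
      primeWeight (mIndex n q (w ^ 2)) * (1 / (w : ℚ) ^ 2) *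
        (Nat.gcd n (q ^ (w ^ 2) - 1) : ℚ)) := by
  have hq2 : 2 ≤ q := hF ▸ Finite.one_lt_card
  have hwpos : 0 < w := hw.pos
  have hw2pos : 0 < w ^ 2 := by positivity
  have hfinE : Finite E := Nat.finite_of_card_ne_zero (by rw [hE]; positivity)
  have hfinK : Finite K := Nat.finite_of_card_ne_zero (by rw [hK]; positivity)
  have hA₁ : 0 < q ^ 1 - 1 := by rw [pow_one]; omega
  have hA₂ : 0 < q ^ w - 1 := Nat.sub_pos_of_lt (Nat.one_lt_pow hwpos.ne' (by omega))
  have hA₃ : 0 < q ^ w ^ 2 - 1 := Nat.sub_pos_of_lt (Nat.one_lt_pow hw2pos.ne' (by omega))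
  have hA₁₂ : q ^ 1 - 1 ∣ q ^ w - 1 := Nat.pow_sub_one_dvd_pow_sub_one q (one_dvd w)
  have hA₂₃ : q ^ w - 1 ∣ q ^ w ^ 2 - 1 :=
    Nat.pow_sub_one_dvd_pow_sub_one q (dvd_pow_self w two_ne_zero)
  have h0 : n₁ ≠ 0 ∧ n₂ ≠ 0 ∧ n₃ ≠ 0 := by
    refine ⟨?_, ?_, ?_⟩ <;> rintro rfl <;> simp at hdecomp <;> omega
  have hrad : ∀ p, p.Prime → p ∣ n → p ∣ q ^ w ^ 2 - 1 := by
    have h1 := pow_orderOf_eq_one (q : ZMod (UniqueFactorizationMonoid.radical n))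
    rw [hord, ← Nat.cast_pow, ← Nat.cast_one, ZMod.natCast_eq_natCast_iff] at h1
    have h2 := (Nat.modEq_iff_dvd' (Nat.one_le_pow _ _ (by omega))).1 h1.symm
    exact fun p => prime_dvd_of_radical_dvd hn.ne' h2
  have hpr₁ : ∀ p, p.Prime → p ∣ n₁ → p ∣ q - 1 := fun p => prime_dvd_of_radical_dvd h0.1 hn₁
  obtain ⟨hpr₁₂, hlev₂, hlev₃⟩ := tower_arithmetic hq2 hw hn hrad hdecomp hpr₁
    (fun p => prime_dvd_of_radical_dvd h0.2.1 hn₂) (fun p => prime_dvd_of_radical_dvd h0.2.2 hn₃)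
  have d₁₂ : n₁ * n₂ ∣ n := ⟨w ^ padicValNat w n * n₃, by
    conv_lhs => rw [hdecomp]
    ring⟩
  have d₁ : n₁ ∣ n := (dvd_mul_right _ _).trans d₁₂
  have hmpos : ∀ {x j : ℕ}, x ≠ 0 → mIndex x q j ≠ 0 := fun {x j} hx =>
    (Nat.div_pos (Nat.gcd_le_left _ (Nat.pos_of_ne_zero hx))
      (Nat.gcd_pos_of_pos_left _ (Nat.pos_of_ne_zero hx))).ne'
  have hm₁ := hmpos (j := 1) h0.1
  have hm₂ := hmpos (j := w) (mul_ne_zero h0.1 h0.2.1)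
  have hm₃ := hmpos (j := w ^ 2) hn.ne'
  have hmdvd : ∀ {x j : ℕ}, mIndex x q j ∣ x := fun {x j} =>
    Nat.div_dvd_of_dvd (Nat.gcd_dvd_left _ _)
  have hmN₁ : ∀ r, r.Prime → r ∣ mIndex n₁ q 1 → r ∣ Nat.gcd n (q ^ 1 - 1) := fun r hr h =>
    Nat.dvd_gcd ((h.trans hmdvd).trans d₁) (by simpa using hpr₁ r hr (h.trans hmdvd))
  have hmN₂ : ∀ r, r.Prime → r ∣ mIndex (n₁ * n₂) q w → r ∣ Nat.gcd n (q ^ w - 1) :=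
    fun r hr h => Nat.dvd_gcd ((h.trans hmdvd).trans d₁₂) (hpr₁₂ r hr (h.trans hmdvd))
  have hmN₃ : ∀ r, r.Prime → r ∣ mIndex n q (w ^ 2) → r ∣ Nat.gcd n (q ^ w ^ 2 - 1) :=
    fun r hr h => Nat.dvd_gcd (h.trans hmdvd) (hrad r hr (h.trans hmdvd))
  -- proper divisors of `w` divide `1`, and proper divisors of `w ^ 2` divide `w`
  have hab₂ : ∀ j, j ∣ w → j ≠ w → j ∣ 1 := fun j h1 h2 =>
    Nat.dvd_one.2 (((Nat.dvd_prime hw).1 h1).resolve_right h2)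
  have hab₃ : ∀ j, j ∣ w ^ 2 → j ≠ w ^ 2 → j ∣ w := by
    intro j h1 h2
    obtain ⟨i, hi, rfl⟩ := (Nat.dvd_prime_pow hw).1 h1
    have : i ≠ 2 := fun e => h2 (by rw [e])
    simpa using pow_dvd_pow w (show i ≤ 1 by omega)
  have hgcd : ∀ {b a : ℕ}, (∀ j, j ∣ b → j ≠ b → j ∣ a) →
      ∀ j, 0 < j → j < b → Nat.gcd j b ∣ a := fun h j h1 h2 =>
    h _ (Nat.gcd_dvd_right _ _) ((Nat.gcd_le_left _ h1).trans_lt h2).ne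
  -- the orders of `δ`, `π` and `θ`
  have hδ' : ∀ s, (δ : K) ^ s = 1 ↔ q ^ w ^ 2 - 1 ∣ s := by
    intro s
    have h1 : orderOf δ = q ^ w ^ 2 - 1 := by
      rw [orderOf_eq_card_of_forall_mem_zpowers hδ, Nat.card_units, hK]
    rw [← h1, orderOf_dvd_iff_pow_eq_one, ← Units.val_pow_eq_pow_val, Units.val_eq_one]
  have hπ' : ∀ s, π ^ s = 1 ↔ q ^ w - 1 ∣ s :=
    pow_eq_one_iff_of_algebraMap_eq_pow hA₃ hA₂₃ hδ' hπ
  have hθπ : algebraMap F E θ = π ^ ((q ^ w - 1) / (q ^ 1 - 1)) := by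
    apply (algebraMap E K).injective
    rw [← IsScalarTower.algebraMap_apply, hθ, map_pow, hπ, ← pow_mul, pow_one,
      Nat.div_mul_div_comm hA₂₃ (by simpa using hA₁₂), mul_comm (q ^ w ^ 2 - 1),
      Nat.mul_div_mul_left _ _ hA₂]
  have hθ' : ∀ s, θ ^ s = 1 ↔ q ^ 1 - 1 ∣ s :=
    pow_eq_one_iff_of_algebraMap_eq_pow hA₂ hA₁₂ hπ' hθπ
  -- the factors
  let f : ℕ → ℕ → F[X] := fun t u => X ^ t - C (θ ^ (u * lIndex n q 1))
  let g : ℕ → ℕ → F[X] := fun t u => expand F t (minpoly F (π ^ (u * lIndex n q w)))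
  let h : ℕ → ℕ → F[X] := fun t u => expand F t (minpoly F ((δ : K) ^ (u * lIndex n q (w ^ 2))))
  have hdegπ : ∀ t u, u ∈ orbitReps n q 1 w t →
      (minpoly F (π ^ (u * lIndex n q w))).natDegree = w := fun t u hu =>
    natDegree_minpoly_of_mem_orbitReps hF hE hwpos (one_dvd w) hab₂ hπ' hu
  have hdegδ : ∀ t u, u ∈ orbitReps n q w (w ^ 2) t →
      (minpoly F ((δ : K) ^ (u * lIndex n q (w ^ 2)))).natDegree = w ^ 2 := fun t u hu =>
    natDegree_minpoly_of_mem_orbitReps hF hK hw2pos (dvd_pow_self w two_ne_zero) hab₃ hδ' hu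
  have hf_irr : ∀ t ∈ (mIndex n₁ q 1).divisors,
      ∀ u ∈ (Finset.Icc 1 (Nat.gcd n (q - 1))).filter (fun u => Nat.gcd u t = 1),
        Irreducible (f t u) := by
    intro t ht u hu
    have := irreducible_expand_minpoly (M := F) hF hn.ne' d₁ odd_one hq (by simpa using hpr₁)
      (Nat.dvd_of_mem_divisors ht) (Finset.mem_filter.1 hu).2 hθ'
      (by rw [minpoly.eq_X_sub_C', natDegree_X_sub_C])
    rwa [minpoly.eq_X_sub_C', map_sub, expand_X, expand_C] at this
  have hg_irr : ∀ t ∈ (mIndex (n₁ * n₂) q w).divisors, ∀ u ∈ orbitReps n q 1 w t,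
      Irreducible (g t u) := fun t ht u hu =>
    irreducible_expand_minpoly hF hn.ne' d₁₂ hw_odd hq hpr₁₂ (Nat.dvd_of_mem_divisors ht)
      (Finset.mem_filter.1 hu).2.1 hπ' (hdegπ t u hu)
  have hh_irr : ∀ t ∈ (mIndex n q (w ^ 2)).divisors, ∀ u ∈ orbitReps n q w (w ^ 2) t,
      Irreducible (h t u) := fun t ht u hu =>
    irreducible_expand_minpoly hF hn.ne' dvd_rfl hw_odd.pow hq hrad (Nat.dvd_of_mem_divisors ht)
      (Finset.mem_filter.1 hu).2.1 hδ' (hdegδ t u hu)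
  have hg_map : ∀ t u, u ∈ orbitReps n q 1 w t → (g t u).map (algebraMap F E) =
      ∏ k ∈ Finset.range w, (X ^ t - C (π ^ (q ^ k * u * lIndex n q w))) := fun t u hu => by
    simpa only [mul_assoc] using map_expand_minpoly_eq_prod (t := t) hF (hdegπ t u hu)
  have hh_map : ∀ t u, u ∈ orbitReps n q w (w ^ 2) t → (h t u).map (algebraMap F K) =
      ∏ k ∈ Finset.range (w ^ 2), (X ^ t - C ((δ : K) ^ (q ^ k * u * lIndex n q (w ^ 2)))) :=
    fun t u hu => by
    simpa only [mul_assoc] using map_expand_minpoly_eq_prod (t := t) hF (hdegδ t u hu)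
  have hprod : (X ^ n - 1 : F[X]) =
      (∏ t ∈ (mIndex n₁ q 1).divisors,
        ∏ u ∈ (Finset.Icc 1 (Nat.gcd n (q - 1))).filter (fun u => Nat.gcd u t = 1), f t u) *
      (∏ t ∈ (mIndex (n₁ * n₂) q w).divisors, ∏ u ∈ orbitReps n q 1 w t, g t u) *
      (∏ t ∈ (mIndex n q (w ^ 2)).divisors, ∏ u ∈ orbitReps n q w (w ^ 2) t, h t u) := by
    apply map_injective _ (algebraMap F K).injective
    have hdesc₃ : ∀ v, (δ : K) ^ (v * (Nat.gcd n (q ^ w ^ 2 - 1) / Nat.gcd n (q ^ w - 1)) *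
        lIndex n q (w ^ 2)) = algebraMap E K (π ^ (v * lIndex n q w)) := fun v => by
      rw [map_pow, hπ, ← pow_mul, mul_assoc, lIndex_mul_quotient hn (dvd_pow_self w two_ne_zero),
        mul_left_comm]
    have hdesc₂ : ∀ v, π ^ (v * (Nat.gcd n (q ^ w - 1) / Nat.gcd n (q ^ 1 - 1)) *
        lIndex n q w) = algebraMap F E (θ ^ (v * lIndex n q 1)) := fun v => by
      rw [map_pow, hθπ, ← pow_mul, mul_assoc, lIndex_mul_quotient hn (one_dvd w), mul_left_comm]
    have e₂ := prod_coprime_eq_prod_mul_prod_orbitReps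
      (Ψ := fun t u => (X ^ t - C (algebraMap E K (π ^ (u * lIndex n q w))) : K[X]))
      hq2 one_pos hwpos (one_dvd w) hn hm₂ hm₁ (hgcd hab₂) hmN₂ hlev₂
      (fun t u => by simp only [periodic_pow_mul_lIndex hπ' u])
    have e₃ := prod_coprime_eq_prod_mul_prod_orbitReps
      (Ψ := fun t u => (X ^ t - C ((δ : K) ^ (u * lIndex n q (w ^ 2))) : K[X]))
      hq2 hwpos hw2pos (dvd_pow_self w two_ne_zero) hn hm₃ hm₂ (hgcd hab₃) hmN₃ hlev₃
      (fun t u => by simp only [periodic_pow_mul_lIndex hδ' u])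
    simp only [hdesc₂] at e₂
    simp only [hdesc₃] at e₃
    rw [show (X ^ n - 1 : F[X]).map (algebraMap F K) = X ^ n - 1 by simp,
      X_pow_sub_one_eq_prod_binomials hK hq2 hn.ne' hw_odd.pow hq hrad hδ', e₃, e₂, pow_one,
      Polynomial.map_mul, Polynomial.map_mul]
    simp only [Polynomial.map_prod]
    congr 1
    · congr 1
      · refine Finset.prod_congr rfl fun t _ => Finset.prod_congr rfl fun u _ => ?_
        simp only [f, Polynomial.map_sub, Polynomial.map_pow, map_X, map_C]
        rw [← IsScalarTower.algebraMap_apply F E K]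
      · refine Finset.prod_congr rfl fun t _ => Finset.prod_congr rfl fun u hu => ?_
        rw [IsScalarTower.algebraMap_eq F E K, ← Polynomial.map_map, hg_map t u hu,
          Polynomial.map_prod]
        simp only [Polynomial.map_sub, Polynomial.map_pow, map_X, map_C]
    · exact Finset.prod_congr rfl fun t _ => Finset.prod_congr rfl fun u hu =>
        (hh_map t u hu).symm
  refine ⟨⟨g, h, hf_irr, fun t ht u hu => ⟨hg_irr t ht u hu, hg_map t u hu⟩,
    fun t ht u hu => ⟨hh_irr t ht u hu, hh_map t u hu⟩, hprod⟩, ?_⟩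
  -- `X ^ n - 1` is squarefree, so the factors are distinct and it remains to count the indices
  have hsq : Squarefree (X ^ n - 1 : F[X]) := by
    refine (X_pow_sub_one_separable_iff.2 fun h0 => ?_).squarefree
    have h1 := (Nat.isCoprime_iff_coprime.2 hnq).map (Int.castRingHom F)
    have h2 : (q : F) = 0 := by
      rw [← hF]
      have := Fintype.ofFinite F
      rw [Nat.card_eq_fintype_card, FiniteField.cast_card_eq_zero]
    simp [h0, h2] at h1
  let T₁ := (mIndex n₁ q 1).divisors.sigma fun t =>
    (Finset.Icc 1 (Nat.gcd n (q - 1))).filter (fun u => Nat.gcd u t = 1)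
  let T₂ := (mIndex (n₁ * n₂) q w).divisors.sigma fun t => orbitReps n q 1 w t
  let T₃ := (mIndex n q (w ^ 2)).divisors.sigma fun t => orbitReps n q w (w ^ 2) t
  have hcount := ncard_monic_irreducible_dvd hsq
    (S := T₁.val.map (fun x => f x.1 x.2) + T₂.val.map (fun x => g x.1 x.2) +
      T₃.val.map (fun x => h x.1 x.2)) ?_ ?_
  rotate_left
  · intro p hp
    simp only [Multiset.mem_add, Multiset.mem_map, Finset.mem_val, T₁, T₂, T₃,
      Finset.mem_sigma] at hp
    rcases hp with (⟨x, hx, rfl⟩ | ⟨x, hx, rfl⟩) | ⟨x, hx, rfl⟩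
    · exact ⟨monic_X_pow_sub_C _ (Nat.pos_of_mem_divisors hx.1).ne', hf_irr _ hx.1 _ hx.2⟩
    · exact ⟨(minpoly.monic (Algebra.IsIntegral.isIntegral _)).expand
        (Nat.pos_of_mem_divisors hx.1), hg_irr _ hx.1 _ hx.2⟩
    · exact ⟨(minpoly.monic (Algebra.IsIntegral.isIntegral _)).expand
        (Nat.pos_of_mem_divisors hx.1), hh_irr _ hx.1 _ hx.2⟩
  · rw [hprod, Multiset.prod_add, Multiset.prod_add, Finset.prod_sigma', Finset.prod_sigma',
      Finset.prod_sigma']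
    rfl
  rw [hcount]
  simp only [Multiset.card_add, Multiset.card_map, Finset.card_val, T₁, T₂, T₃, Finset.card_sigma]
  have c₂ := sum_coprime_eq_sum_add_sum_orbitReps (M := ℕ) (Ψ := fun _ _ => 1)
      hq2 one_pos hwpos (one_dvd w) hn hm₂ hm₁ (hgcd hab₂) hmN₂ hlev₂ (fun t u => rfl)
  have c₃ := sum_coprime_eq_sum_add_sum_orbitReps (M := ℕ) (Ψ := fun _ _ => 1)
      hq2 hwpos hw2pos (dvd_pow_self w two_ne_zero) hn hm₃ hm₂ (hgcd hab₃) hmN₃ hlev₃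
      (fun t u => rfl)
  -- the numbers of pairs at the three levels
  have s₁ := sum_card_coprime_Icc hm₁ hmN₁
  have s₂ := sum_card_coprime_Icc hm₂ hmN₂
  have s₃ := sum_card_coprime_Icc hm₃ hmN₃
  simp only [Finset.sum_const, Finset.card_range, smul_eq_mul, mul_one, ← Finset.sum_mul] at c₂ c₃
  rw [c₃, c₂] at s₃
  rw [c₂] at s₂
  rw [pow_one] at s₁ s₂ s₃
  push_cast at s₁ s₂ s₃ ⊢
  have hw0 : (w : ℚ) ≠ 0 := by exact_mod_cast hwpos.ne'
  linear_combination (norm := skip) (((w : ℚ) - 1) / w) * s₁ + (((w : ℚ) - 1) / w ^ 2) * s₂ +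
    (1 / (w : ℚ) ^ 2) * s₃
  field_simp
  ring
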